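/- \textbf{Conventions.} All measures are $\sigma$-finite. For a measure $\mu$ on a measurable space $(X,\Sigma)$, $L^0(\mu)$ is the algebra of real-valued measurable functions on $X$ modulo $\mu$-a.e. equality, with the distance $d_{L^0(\mu)}(f,g)=\int |f-g|\wedge 1\,d\tilde\mu$, where $\tilde\mu$ is a finite measure with $\mu\ll\tilde\mu\le\mu$ ($\tilde\mu=\mu$ if $\mu$ is finite). An \emph{$L^0(\mu)$-Banach $L^0(\mu)$-module} is a module $\mathscr M$ over $L^0(\mu)$ that is also a real vector space with the same addition, satisfies $(\lambda f)\cdot v=\lambda(f\cdot v)$, and carries a pointwise norm $|\cdot|:\mathscr M\to L^0(\mu)$ (i.e. $|v|\ge 0$ with equality iff $v=0$, $|v+w|\le|v|+|w|$, $|\lambda v|=|\lambda||v|$, $|f\cdot v|=|f||v|$ for $\lambda\in\mathbb R$, $f\in L^0(\mu)$) whose distance $d_{\mathscr M}(v,w)=d_{L^0(\mu)}(|v-w|,0)$ is complete. A linear subspace $V\subseteq\mathscr M$ \emph{generates} $\mathscr M$ if the set $\mathcal G(V)$ of all sums $\sum_{n}\mathbf 1_{E_n}\cdot v_n$, with $(E_n)_{n\in\mathbb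 N}\subseteq\Sigma$ a partition of $X$ and $v_n\in V$, is dense in $\mathscr M$; $\mathscr M$ is \emph{countably generated} if it is generated by the linear span of a countable set. An isomorphism of such modules is an $L^0(\mu)$-linear bijection preserving the pointwise norm. Let $(Q,\mathcal Q,\mathfrak q)$ be a measure space. A \emph{disjoint measure-valued map} $q\mapsto\mu_q$ from $Q$ to $(X,\Sigma)$ is a family of measures on $(X,\Sigma)$ such that $q\mapsto\mu_q(E)$ is measurable for every $E\in\Sigma$; the measure $\mu=\int\mu_q\,d\mathfrak q(q)$, $\mu(E)=\int\mu_q(E)\,d\mathfrak q(q)$, is $\sigma$-finite; and there are pairwise disjoint $E_q\in\Sigma$ with $\mu_q(X\setminus E_q)=0$ for all $q$ and $\bigcup_{q\in A}E_q\in\Sigma$ for all $A\in\mathcal Q$. For a family $\mathscr M_\star=\{\mathscr M_q\}_{q\in Q}$ of $L^0(\mu_q)$-Banach $L^0(\mu_q)$-modules let $\mathscr S_{\mathfrak q}(\mathscr M_\star)$ be $\prod_q\mathscr M_q$ modulo equality for $\mathfrak q$-a.e. $q$, and define the ring $\mathscr S_{\mathfrak q}(L^0(\mu_\star))$ likewise;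 the former is a module over the latter. Let $L^0(\mathfrak q;L^0(\mu_\star))\subseteq\mathscr S_{\mathfrak q}(L^0(\mu_\star))$ be the set of classes of the families $q\mapsto[F]_{\mu_q}$ with $F:X\to\mathbb R$ measurable; the map $[F]_\mu\mapsto(q\mapsto[F]_{\mu_q})$ is a well-defined bijection $L^0(\mu)\to L^0(\mathfrak q;L^0(\mu_\star))$, with inverse $\mathsf j_{\mathfrak q}$. For $v\in\mathscr S_{\mathfrak q}(\mathscr M_\star)$ let $|v_\star|\in\mathscr S_{\mathfrak q}(L^0(\mu_\star))$ be the class of $q\mapsto|v_q|$. A \emph{Banach module bundle} consistent with $q\mapsto\mu_q$ is a triple $(\mathscr M_\star,\Theta,\Phi)$ where: each $\mathscr M_q$, $q\in Q$, is an $L^0(\mu_q)$-Banach $L^0(\mu_q)$-module; $\Phi$ is a (not necessarily unital) real subalgebra of $L^0(\mathfrak q;L^0(\mu_\star))$ such that the set of all $\sum_n\mathsf j_{\mathfrak q}(\mathbf 1_{S_n}f_n)$, with $(S_n)_{n\in\mathbb N}\subseteq\mathcal Q$ a partition of $Q$ and $f_n\in\Phi$, is dense in $L^0(\mu)$; and $\Theta$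 is a linear subspace of $\mathscr S_{\mathfrak q}(\mathscr M_\star)$, closed under multiplication by elements of $\Phi$, with $|v_\star|\in L^0(\mathfrak q;L^0(\mu_\star))$ for every $v\in\Theta$. Its \emph{integral} $\int\mathscr M_q\,d\mathfrak q(q)$ is the completion of $\Theta$ with the pointwise norm $|v|=\mathsf j_{\mathfrak q}(|v_\star|)$: the $L^0(\mu)$-Banach $L^0(\mu)$-module $\mathscr N$, unique up to isomorphism, that admits a linear map $\iota:\Theta\to\mathscr N$ with $|\iota(v)|=|v|$ for all $v\in\Theta$ and with generating image. \textbf{Theorem.} Let $(Q,\mathcal Q,\mathfrak q)$ be a measure space, $(X,\Sigma)$ a measurable space, $q\mapsto\mu_q$ a disjoint measure-valued map from $Q$ to $X$, and $\mu=\int\mu_q\,d\mathfrak q(q)$. Let $\mathscr M$ be a countably generated $L^0(\mu)$-Banach $L^0(\mu)$-module. Then there exists a Banach module bundle $(\mathscr M_\star,\Theta,\Phi)$ consistent with $q\mapsto\mu_q$, whose integral exists and satisfies $$\mathscr M\cong\int\mathscr M_q\,d\mathfrak q(q).$$ -/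

import Mathlib

open MeasureTheory Filter Topology
open scoped ENNReal

universe u v w w'

/-! ## The algebra `L⁰(μ)` -/

/-- `L⁰(μ)`: real-valued measurable functions up to `μ`-a.e. equality. -/
abbrev L0 {X : Type u} [MeasurableSpace X] (μ : Measure X) : Type u := X →ₘ[μ] ℝ

namespace L0

section
variable {X : Type u} [MeasurableSpace X] {μ : Measure X}

noncomputable instance instCommRing : CommRing (L0 μ) :=
  { (inferInstance : AddCommGroup (X →ₘ[μ] ℝ)), (inferInstance : CommMonoid (X →ₘ[μ] ℝ)) with
    left_distrib := fun a b c => AEEqFun.induction_on₃ a b c fun f hf g hg h hh => by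
      simp only [AEEqFun.mk_add_mk, AEEqFun.mk_mul_mk, mul_add]
    right_distrib := fun a b c => AEEqFun.induction_on₃ a b c fun f hf g hg h hh => by
      simp only [AEEqFun.mk_add_mk, AEEqFun.mk_mul_mk, add_mul]
    zero_mul := fun a => AEEqFun.induction_on a fun f hf => by
      simp only [AEEqFun.zero_def, AEEqFun.mk_mul_mk, AEEqFun.mk_eq_mk]
      exact Eventually.of_forall fun x => by simp
    mul_zero := fun a => AEEqFun.induction_on a fun f hf => by
      simp only [AEEqFun.zero_def, AEEqFun.mk_mul_mk, AEEqFun.mk_eq_mk]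
      exact Eventually.of_forall fun x => by simp }

instance instIsScalarTower : IsScalarTower ℝ (L0 μ) (L0 μ) :=
  ⟨fun c a b => AEEqFun.induction_on₂ a b fun f hf g hg => by
    simp only [smul_eq_mul, AEEqFun.smul_mk, AEEqFun.mk_mul_mk, smul_mul_assoc]⟩

/-- The class of a measurable function. -/
noncomputable def of (μ : Measure X) (F : X → ℝ) (hF : Measurable F) : L0 μ :=
  AEEqFun.mk F hF.aestronglyMeasurable

/-- The class of the characteristic function of a measurable set. -/
noncomputable def ind (μ : Measure X) (E : Set X) (hE : MeasurableSet E) : L0 μ :=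
  of μ (E.indicator fun _ => 1) (measurable_const.indicator hE)

theorem exists_refMeasure (μ : Measure X) [SigmaFinite μ] :
    ∃ ν : Measure X, IsFiniteMeasure ν ∧ μ ≪ ν ∧ ν ≤ μ ∧ (IsFiniteMeasure μ → ν = μ) := by
  by_cases h : IsFiniteMeasure μ
  · exact ⟨μ, h, Measure.AbsolutelyContinuous.rfl, le_rfl, fun _ => rfl⟩
  · obtain ⟨g, hg0, hgm, hg⟩ := exists_pos_lintegral_lt_of_sigmaFinite μ one_ne_zero
    have hm : Measurable fun x => min (g x : ℝ≥0∞) 1 := hgm.coe_nnreal_ennreal.min measurable_const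
    refine ⟨μ.withDensity fun x => min (g x : ℝ≥0∞) 1, ?_, ?_, ?_, fun h' => absurd h' h⟩
    · refine isFiniteMeasure_withDensity (ne_of_lt ?_)
      exact (lintegral_mono fun x => min_le_left _ _).trans_lt (hg.trans ENNReal.one_lt_top)
    · refine withDensity_absolutelyContinuous' hm.aemeasurable (Eventually.of_forall fun x => ?_)
      simpa using (hg0 x).ne'
    · calc μ.withDensity (fun x => min (g x : ℝ≥0∞) 1) ≤ μ.withDensity 1 :=
            withDensity_mono (Eventually.of_forall fun x => min_le_right _ _)
        _ = μ := withDensity_one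

/-- A finite measure `μ̃` with `μ ≪ μ̃ ≤ μ`, equal to `μ` when `μ` is finite. -/
noncomputable def refMeasure (μ : Measure X) [SigmaFinite μ] : Measure X :=
  (exists_refMeasure μ).choose

/-- The distance `∫ |f - g| ∧ 1 dμ̃` on `L⁰(μ)`. -/
noncomputable def dist [SigmaFinite μ] (f g : L0 μ) : ℝ :=
  ∫ x, min |f x - g x| 1 ∂(refMeasure μ)

/-- Density of a subset of `L⁰(μ)`. -/
def IsDense [SigmaFinite μ] (S : Set (L0 μ)) : Prop :=
  ∀ f : L0 μ, ∀ ε : ℝ, 0 < ε → ∃ g ∈ S, dist f g < ε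

end

end L0

/-- A countable measurable partition (members may be empty). -/
structure IsMeasurablePartition {X : Type u} [MeasurableSpace X] (E : ℕ → Set X) : Prop where
  measurableSet : ∀ n, MeasurableSet (E n)
  disjoint : Pairwise fun i j => Disjoint (E i) (E j)
  iUnion_eq : ⋃ n, E n = Set.univ

/-! ## Banach modules -/

/-- An `L⁰(μ)`-Banach `L⁰(μ)`-module: a module over `L⁰(μ)`, with a compatible structure of real
vector space and a pointwise norm inducing a complete distance. -/
structure L0BanachModule {X : Type u} [MeasurableSpace X] (μ : Measure X) [SigmaFinite μ] where
  carrier : Type w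
  [addCommGroup : AddCommGroup carrier]
  [module : Module (L0 μ) carrier]
  [realModule : Module ℝ carrier]
  /-- The pointwise norm `|·|`. -/
  pnorm : carrier → L0 μ
  pnorm_nonneg : ∀ v, 0 ≤ pnorm v
  pnorm_eq_zero : ∀ v, pnorm v = 0 ↔ v = 0
  pnorm_add_le : ∀ v w, pnorm (v + w) ≤ pnorm v + pnorm w
  pnorm_real_smul : ∀ (c : ℝ) (v), pnorm (c • v) = |c| • pnorm v
  pnorm_smul : ∀ (f : L0 μ) (v), pnorm (f • v) = |f| * pnorm v
  smul_assoc : ∀ (c : ℝ) (f : L0 μ) (v : carrier), (c • f) • v = c • f • v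
  complete : ∀ a : ℕ → carrier,
    (∀ ε : ℝ, 0 < ε → ∃ N, ∀ i ≥ N, ∀ j ≥ N, L0.dist (pnorm (a i - a j)) 0 < ε) →
    ∃ v, Tendsto (fun n => L0.dist (pnorm (a n - v)) 0) atTop (𝓝 0)

attribute [instance] L0BanachModule.addCommGroup L0BanachModule.module L0BanachModule.realModule

namespace L0BanachModule

section
variable {X : Type u} [MeasurableSpace X] {μ : Measure X} [SigmaFinite μ]

instance instIsScalarTower (M : L0BanachModule.{u, w} μ) :
    IsScalarTower ℝ (L0 μ) M.carrier := ⟨M.smul_assoc⟩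

/-- The distance `d_M(v, w) = d_{L⁰(μ)}(|v - w|, 0)`. -/
noncomputable def dist (M : L0BanachModule.{u, w} μ) (v w : M.carrier) : ℝ :=
  L0.dist (M.pnorm (v - w)) 0

/-- `𝒢(V)`: the elements `∑ₙ 1_{Eₙ} • vₙ` with `(Eₙ)` a countable measurable partition of `X` and
`vₙ ∈ V`. Such a sum is the unique `g` with `1_{Eₙ} • g = 1_{Eₙ} • vₙ` for all `n`. -/
def glue (M : L0BanachModule.{u, w} μ) (V : Set M.carrier) : Set M.carrier :=
  {g | ∃ (E : ℕ → Set X) (hE : IsMeasurablePartition E) (a : ℕ → M.carrier), (∀ n, a n ∈ V) ∧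
    ∀ n, L0.ind μ (E n) (hE.measurableSet n) • g = L0.ind μ (E n) (hE.measurableSet n) • a n}

/-- `V` generates `M` if `𝒢(V)` is dense in `M`. -/
def Generates (M : L0BanachModule.{u, w} μ) (V : Submodule ℝ M.carrier) : Prop :=
  ∀ v : M.carrier, ∀ ε : ℝ, 0 < ε → ∃ g ∈ M.glue V, M.dist v g < ε

/-- `M` is countably generated if the linear span of some countable set generates `M`. -/
def CountablyGenerated (M : L0BanachModule.{u, w} μ) : Prop :=
  ∃ C : Set M.carrier, C.Countable ∧ M.Generates (Submodule.span ℝ C)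

/-- Isomorphism: an `L⁰(μ)`-linear bijection preserving the pointwise norm. -/
def Isomorphic (M : L0BanachModule.{u, w} μ) (N : L0BanachModule.{u, w'} μ) : Prop :=
  ∃ e : M.carrier ≃ₗ[L0 μ] N.carrier, ∀ v, N.pnorm (e v) = M.pnorm v

/-- `(N, ι)` is the completion of the real vector space `V` with pointwise norm `nrm`: `N` is an
`L⁰(μ)`-Banach `L⁰(μ)`-module and `ι : V → N` is linear, preserves the pointwise norm and has
generating image. -/
def IsCompletion {V : Type w'} [AddCommGroup V] [Module ℝ V] (nrm : V → L0 μ)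
    (N : L0BanachModule.{u, w} μ) (ι : V →ₗ[ℝ] N.carrier) : Prop :=
  (∀ v, N.pnorm (ι v) = nrm v) ∧ N.Generates (LinearMap.range ι)

end

end L0BanachModule

/-! ## Measure-valued maps -/

section
variable {Q : Type v} [MeasurableSpace Q] {X : Type u} [MeasurableSpace X]

/-- The measure `∫ μ_q d𝔮(q)`, that is `E ↦ ∫ μ_q(E) d𝔮(q)`; see `integralMeasure_apply`. -/
noncomputable def integralMeasure (𝔮 : Measure Q) (m : Q → Measure X) : Measure X :=
  𝔮.bind m

/-- `q ↦ μ_q` is a disjoint measure-valued map from `Q` to `X`. -/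
class IsDisjointMeasureValuedMap (𝔮 : Measure Q) (m : Q → Measure X) : Prop where
  measurable : ∀ E, MeasurableSet E → Measurable fun q => m q E
  sigmaFinite : SigmaFinite (integralMeasure 𝔮 m)
  disjoint : ∃ E : Q → Set X, (∀ q, MeasurableSet (E q)) ∧
    (Pairwise fun p q => Disjoint (E p) (E q)) ∧ (∀ q, m q (E q)ᶜ = 0) ∧
    ∀ A : Set Q, MeasurableSet A → MeasurableSet (⋃ q ∈ A, E q)

variable {𝔮 : Measure Q} {m : Q → Measure X}

instance instSigmaFiniteIntegralMeasure [h : IsDisjointMeasureValuedMap 𝔮 m] :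
    SigmaFinite (integralMeasure 𝔮 m) := h.sigmaFinite

theorem integralMeasure_apply [h : IsDisjointMeasureValuedMap 𝔮 m] {E : Set X}
    (hE : MeasurableSet E) : integralMeasure 𝔮 m E = ∫⁻ q, m q E ∂𝔮 :=
  Measure.bind_apply hE (Measure.measurable_of_measurable_coe m h.measurable).aemeasurable

theorem ae_ae_of_ae_integralMeasure [h : IsDisjointMeasureValuedMap 𝔮 m] {p : X → Prop}
    (hp : ∀ᵐ x ∂(integralMeasure 𝔮 m), p x) : ∀ᵐ q ∂𝔮, ∀ᵐ x ∂(m q), p x := by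
  obtain ⟨t, hpt, ht, ht0⟩ := exists_measurable_superset_of_null (ae_iff.1 hp)
  rw [integralMeasure_apply ht, lintegral_eq_zero_iff (h.measurable t ht)] at ht0
  filter_upwards [ht0] with q hq
  exact ae_iff.2 (measure_mono_null hpt hq)

/-! ## Sections modulo `𝔮`-a.e. equality -/

/-- The ideal of those `f ∈ ∏_q L⁰(μ_q)` that vanish for `𝔮`-a.e. `q`. -/
def nullIdeal (𝔮 : Measure Q) (m : Q → Measure X) : Ideal (∀ q, L0 (m q)) where
  carrier := {f | ∀ᵐ q ∂𝔮, f q = 0}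
  zero_mem' := by
    change ∀ᵐ q ∂𝔮, (0 : ∀ q, L0 (m q)) q = 0
    exact Eventually.of_forall fun _ => rfl
  add_mem' := fun {a b} ha hb => by
    change ∀ᵐ q ∂𝔮, (a + b) q = 0
    filter_upwards [show ∀ᵐ q ∂𝔮, a q = 0 from ha, show ∀ᵐ q ∂𝔮, b q = 0 from hb] with q h₁ h₂
    simp [h₁, h₂]
  smul_mem' := fun c a ha => by
    change ∀ᵐ q ∂𝔮, (c • a) q = 0
    filter_upwards [show ∀ᵐ q ∂𝔮, a q = 0 from ha] with q h₁
    simp [h₁]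

/-- The ring `𝒮_𝔮(L⁰(μ_⋆))`. -/
abbrev RingSections (𝔮 : Measure Q) (m : Q → Measure X) : Type (max u v) :=
  (∀ q, L0 (m q)) ⧸ nullIdeal 𝔮 m

/-- The projection `∏_q L⁰(μ_q) → 𝒮_𝔮(L⁰(μ_⋆))`. -/
noncomputable def RingSections.mk (𝔮 : Measure Q) {m : Q → Measure X} (f : ∀ q, L0 (m q)) :
    RingSections 𝔮 m := Ideal.Quotient.mk (nullIdeal 𝔮 m) f

theorem RingSections.mk_eq_mk {f g : ∀ q, L0 (m q)} :
    RingSections.mk 𝔮 f = RingSections.mk 𝔮 g ↔ ∀ᵐ q ∂𝔮, f q = g q := by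
  refine Ideal.Quotient.eq.trans ?_
  change (∀ᵐ q ∂𝔮, (f - g) q = 0) ↔ _
  simp only [Pi.sub_apply, sub_eq_zero]

/-- `L⁰(𝔮; L⁰(μ_⋆))` as a subset of `𝒮_𝔮(L⁰(μ_⋆))`. -/
def L0Sections (𝔮 : Measure Q) (m : Q → Measure X) : Set (RingSections 𝔮 m) :=
  RingSections.mk 𝔮 '' {f | ∃ (F : X → ℝ) (hF : Measurable F), ∀ᵐ q ∂𝔮, L0.of (m q) F hF = f q}

/-- The map `𝗂_𝔮 : L⁰(μ) → L⁰(𝔮; L⁰(μ_⋆))`, `[F]_μ ↦ (q ↦ [F]_{μ_q})`, where `μ = ∫ μ_q d𝔮(q)`;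
see `iMap_of` for the independence of the representative. -/
noncomputable def iMap (𝔮 : Measure Q) (m : Q → Measure X)
    (F : L0 (integralMeasure 𝔮 m)) : RingSections 𝔮 m :=
  RingSections.mk 𝔮 fun q => L0.of (m q) F F.stronglyMeasurable.measurable

theorem iMap_of [IsDisjointMeasureValuedMap 𝔮 m] (F : X → ℝ) (hF : Measurable F) :
    iMap 𝔮 m (L0.of (integralMeasure 𝔮 m) F hF) =
      RingSections.mk 𝔮 fun q => L0.of (m q) F hF := by
  refine RingSections.mk_eq_mk.2 ?_
  have h : ∀ᵐ x ∂(integralMeasure 𝔮 m), L0.of (integralMeasure 𝔮 m) F hF x = F x :=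
    AEEqFun.coeFn_mk F hF.aestronglyMeasurable
  filter_upwards [ae_ae_of_ae_integralMeasure h] with q hq
  exact AEEqFun.mk_eq_mk.2 hq

theorem iMap_bijOn [h : IsDisjointMeasureValuedMap 𝔮 m] :
    Set.BijOn (iMap 𝔮 m) Set.univ (L0Sections 𝔮 m) := by
  refine ⟨fun F _ => ?_, fun F _ G _ hFG => ?_, ?_⟩
  · exact ⟨_, ⟨F, F.stronglyMeasurable.measurable, Eventually.of_forall fun _ => rfl⟩, rfl⟩
  · have h₁ := RingSections.mk_eq_mk.1 hFG
    have hm : MeasurableSet {x | F x ≠ G x} :=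
      (measurableSet_eq_fun F.stronglyMeasurable.measurable G.stronglyMeasurable.measurable).compl
    refine AEEqFun.ext (ae_iff.2 ?_)
    change integralMeasure 𝔮 m {x | F x ≠ G x} = 0
    rw [integralMeasure_apply hm, lintegral_eq_zero_iff (h.measurable _ hm)]
    filter_upwards [h₁] with q hq
    exact ae_iff.1 (AEEqFun.mk_eq_mk.1 hq)
  · rintro _ ⟨f, ⟨F, hF, hf⟩, rfl⟩
    exact ⟨L0.of _ F hF, trivial, (iMap_of F hF).trans (RingSections.mk_eq_mk.2 hf)⟩

/-- The inverse `𝗃_𝔮 : L⁰(𝔮; L⁰(μ_⋆)) → L⁰(μ)` of `𝗂_𝔮` (only used on `L⁰(𝔮; L⁰(μ_⋆))`). -/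
noncomputable def jMap (𝔮 : Measure Q) (m : Q → Measure X) :
    RingSections 𝔮 m → L0 (integralMeasure 𝔮 m) :=
  Function.invFunOn (iMap 𝔮 m) Set.univ

theorem iMap_jMap [IsDisjointMeasureValuedMap 𝔮 m] {f : RingSections 𝔮 m}
    (hf : f ∈ L0Sections 𝔮 m) : iMap 𝔮 m (jMap 𝔮 m f) = f :=
  Function.invFunOn_eq (iMap_bijOn.surjOn hf)

theorem jMap_iMap [IsDisjointMeasureValuedMap 𝔮 m] (F : L0 (integralMeasure 𝔮 m)) :
    jMap 𝔮 m (iMap 𝔮 m F) = F :=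
  iMap_bijOn.injOn trivial trivial (iMap_jMap (iMap_bijOn.mapsTo trivial))

open Classical in
/-- The characteristic function `1_S^𝔮` as an element of `𝒮_𝔮(L⁰(μ_⋆))`. -/
noncomputable def sectionInd (𝔮 : Measure Q) (m : Q → Measure X) (S : Set Q) :
    RingSections 𝔮 m :=
  RingSections.mk 𝔮 fun q => if q ∈ S then 1 else 0

/-- `𝒢_𝔮(Φ)`: the elements `∑ₙ 𝗃_𝔮(1_{Sₙ} fₙ)` of `L⁰(μ)`, with `(Sₙ)` a countable measurable
partition of `Q` and `fₙ ∈ Φ`. Such a sum is the unique `g ∈ L⁰(μ)` with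
`1_{Sₙ} 𝗂_𝔮(g) = 1_{Sₙ} fₙ` for all `n`. -/
def glueSections (𝔮 : Measure Q) (m : Q → Measure X) (Φ : Set (RingSections 𝔮 m)) :
    Set (L0 (integralMeasure 𝔮 m)) :=
  {g | ∃ (S : ℕ → Set Q) (f : ℕ → RingSections 𝔮 m), IsMeasurablePartition S ∧ (∀ n, f n ∈ Φ) ∧
    ∀ n, sectionInd 𝔮 m (S n) * iMap 𝔮 m g = sectionInd 𝔮 m (S n) * f n}

section
variable [∀ q, SigmaFinite (m q)]

/-- The sections of `M_⋆` that vanish for `𝔮`-a.e. `q`. -/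
def nullSections (𝔮 : Measure Q) (M : ∀ q, L0BanachModule.{u, w} (m q)) :
    Submodule (∀ q, L0 (m q)) (∀ q, (M q).carrier) where
  carrier := {s | ∀ᵐ q ∂𝔮, s q = 0}
  zero_mem' := by
    change ∀ᵐ q ∂𝔮, (0 : ∀ q, (M q).carrier) q = 0
    exact Eventually.of_forall fun _ => rfl
  add_mem' := fun {a b} ha hb => by
    change ∀ᵐ q ∂𝔮, (a + b) q = 0
    filter_upwards [show ∀ᵐ q ∂𝔮, a q = 0 from ha, show ∀ᵐ q ∂𝔮, b q = 0 from hb] with q h₁ h₂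
    simp [h₁, h₂]
  smul_mem' := fun c a ha => by
    change ∀ᵐ q ∂𝔮, (c • a) q = 0
    filter_upwards [show ∀ᵐ q ∂𝔮, a q = 0 from ha] with q h₁
    simp [h₁]

/-- The space `𝒮_𝔮(M_⋆)` of sections of `M_⋆` up to `𝔮`-a.e. equality. -/
abbrev ModuleSections (𝔮 : Measure Q) (M : ∀ q, L0BanachModule.{u, w} (m q)) :
    Type (max v w) :=
  (∀ q, (M q).carrier) ⧸ nullSections 𝔮 M

/-- `𝒮_𝔮(M_⋆)` is a module over `𝒮_𝔮(L⁰(μ_⋆))`, with `[f] • [s] = [q ↦ f_q • s_q]`. -/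
noncomputable instance ModuleSections.instModule (M : ∀ q, L0BanachModule.{u, w} (m q)) :
    Module (RingSections 𝔮 m) (ModuleSections 𝔮 M) :=
  Module.IsTorsionBySet.module (I := nullIdeal 𝔮 m) (by
    rintro ⟨s⟩ ⟨f, hf⟩
    refine (Submodule.Quotient.mk_eq_zero (nullSections 𝔮 M) (x := f • s)).2 ?_
    filter_upwards [show ∀ᵐ q ∂𝔮, f q = 0 from hf] with q hq
    simp [hq])

/-- The map `v ↦ |v_⋆|`, `[s] ↦ [q ↦ |s_q|]`, from `𝒮_𝔮(M_⋆)` to `𝒮_𝔮(L⁰(μ_⋆))`. -/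
noncomputable def sectionNorm (M : ∀ q, L0BanachModule.{u, w} (m q))
    (s : ModuleSections 𝔮 M) : RingSections 𝔮 m :=
  Quotient.liftOn' s (fun s => RingSections.mk 𝔮 fun q => (M q).pnorm (s q)) (by
    intro s t hst
    refine RingSections.mk_eq_mk.2 ?_
    filter_upwards [show ∀ᵐ q ∂𝔮, (s - t) q = 0 from
      (Submodule.quotientRel_def (nullSections 𝔮 M)).1 hst] with q hq
    rw [sub_eq_zero.1 hq])

/-- A Banach module bundle `(M_⋆, Θ, Φ)` consistent with `q ↦ μ_q`. -/
structure BanachModuleBundle (𝔮 : Measure Q) (m : Q → Measure X) [∀ q, SigmaFinite (m q)]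
    [IsDisjointMeasureValuedMap 𝔮 m] where
  M : ∀ q, L0BanachModule.{u, w} (m q)
  Φ : NonUnitalSubalgebra ℝ (RingSections 𝔮 m)
  Φ_subset : (Φ : Set (RingSections 𝔮 m)) ⊆ L0Sections 𝔮 m
  Φ_dense : L0.IsDense (glueSections 𝔮 m Φ)
  Θ : Submodule ℝ (ModuleSections 𝔮 M)
  smul_mem : ∀ f ∈ Φ, ∀ s ∈ Θ, f • s ∈ Θ
  norm_mem : ∀ s ∈ Θ, sectionNorm M s ∈ L0Sections 𝔮 m

namespace BanachModuleBundle

variable [IsDisjointMeasureValuedMap 𝔮 m]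

/-- The pointwise norm `|s| = 𝗃_𝔮(|s_⋆|) ∈ L⁰(μ)` on `Θ`. -/
noncomputable def norm (B : BanachModuleBundle.{u, v, w} 𝔮 m) (s : B.Θ) :
    L0 (integralMeasure 𝔮 m) :=
  jMap 𝔮 m (sectionNorm B.M s)

/-- `N` is the integral `∫ M_q d𝔮(q)` of the bundle: the completion of `Θ`. -/
def IsIntegral (B : BanachModuleBundle.{u, v, w} 𝔮 m)
    (N : L0BanachModule.{u, w'} (integralMeasure 𝔮 m)) : Prop :=
  ∃ ι : B.Θ →ₗ[ℝ] N.carrier, N.IsCompletion B.norm ι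

end BanachModuleBundle

end

end

/-! A countably generated module embeds isometrically into the bounded sequences in `L⁰(μ)`, and
bounded sequences can be restricted to the fibres `μ_q`. If functionals `φₙ : M → L⁰(μ)` satisfy
`|v| = supₙ |φₙ(v)|` for all `v`, then `v ↦ (φₙ(v))ₙ` preserves the norm. Each fibre is taken to be
the module of a.e. bounded sequences in `L⁰(μ_q)`. The vector `v` becomes the section `q ↦
([φₙ(v)]_{μ_q})ₙ`, and `Θ` is the set of these sections. Restricting representatives respects sums,
products and suprema only up to `μ`-null sets. Such a set is `μ_q`-null for almost every `q`, and a
sequence of functionals produces only countably many of them. Hence `v ↦` section is linear,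
compatible with multiplication by `L⁰(μ)`, and carries `|v|` to the fibrewise norm. So `Θ` is a copy
of `M`, already complete, and `M` is its integral.

The norming sequence comes from Hahn–Banach with values in `L⁰(μ)` (`exists_linearMap_le`), which
needs infima of codirected sets only (`codirectedComplete`). It gives real-linear functionals
bounded by the norm, and such maps are automatically `L⁰(μ)`-linear (`map_smul_of_pnorm_le`).
Norming the countably many rational combinations of the generators suffices: the property passes to
limits, to the real span and to glued elements (`exists_norming_sequence`). The same automatic
linearity shows that any other completion of `Θ` is isomorphic to `M` (`isomorphic_of_generates`).
-/

/-! ## The Hahn–Banach–Kantorovich theorem -/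

section HahnBanach

set_option linter.unusedSectionVars false

variable {V G : Type*} [AddCommGroup V] [Module ℝ V] [AddCommGroup G] [PartialOrder G]
  [IsOrderedAddMonoid G] [Module ℝ G] [PosSMulMono ℝ G]

/-- Every nonempty codirected subset that is bounded below has a greatest lower bound. -/
def CodirectedComplete (G : Type*) [Preorder G] : Prop :=
  ∀ S : Set G, S.Nonempty → DirectedOn (· ≥ ·) S → BddBelow S → ∃ g, IsGLB S g

/-- Subadditive and positively homogeneous maps into an ordered vector space. -/
structure IsSublinear (p : V → G) : Prop where
  add_le : ∀ v w, p (v + w) ≤ p v + p w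
  smul_le : ∀ (c : ℝ) (v), 0 < c → p (c • v) ≤ c • p v

namespace IsSublinear

variable {p : V → G}

/-- The reverse inequality is the assumed one for `c⁻¹` at the vector `c • v`. -/
theorem smul_eq (hp : IsSublinear p) {c : ℝ} (hc : 0 < c) (v : V) : p (c • v) = c • p v := by
  refine (hp.smul_le c v hc).antisymm ?_
  have h := smul_le_smul_of_nonneg_left (hp.smul_le c⁻¹ (c • v) (inv_pos.2 hc)) hc.le
  rwa [smul_smul, smul_smul, inv_mul_cancel₀ hc.ne', mul_inv_cancel₀ hc.ne', one_smul,
    one_smul] at h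

theorem zero_nonneg (hp : IsSublinear p) : 0 ≤ p 0 := by
  have h := hp.add_le 0 0
  rw [add_zero] at h
  exact le_add_iff_nonneg_right _ |>.1 h

/-- Source of the lower bound `-p (-v)` for chains of sublinear maps below `p`, without which their
infimum need not exist. -/
theorem neg_le (hp : IsSublinear p) (v : V) : -p (-v) ≤ p v := by
  have h := hp.zero_nonneg.trans ((congrArg p (add_neg_cancel v)).symm.le.trans (hp.add_le v (-v)))
  exact neg_le_iff_add_nonneg.2 h

/-- Pointwise infima of suitable families are sublinear. -/
theorem of_isGLB {A : V → Set G} {P : V → G} (hP : ∀ v, IsGLB (A v) (P v))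
    (hadd : ∀ v w, ∀ a ∈ A v, ∀ b ∈ A w, ∃ d ∈ A (v + w), d ≤ a + b)
    (hsmul : ∀ (c : ℝ) (v), 0 < c → ∀ a ∈ A v, ∃ d ∈ A (c • v), d ≤ c • a) :
    IsSublinear P where
  add_le v w := by
    rw [← sub_le_iff_le_add]
    refine (le_isGLB_iff (hP v)).2 fun a ha => ?_
    rw [sub_le_comm]
    refine (le_isGLB_iff (hP w)).2 fun b hb => ?_
    obtain ⟨d, hd, hdab⟩ := hadd v w a ha b hb
    rw [sub_le_iff_le_add']
    exact ((hP _).1 hd).trans hdab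
  smul_le c v hc := by
    have h : c⁻¹ • P (c • v) ≤ P v := by
      refine (le_isGLB_iff (hP v)).2 fun a ha => ?_
      obtain ⟨d, hd, hda⟩ := hsmul c v hc a ha
      have := smul_le_smul_of_nonneg_left (((hP _).1 hd).trans hda) (inv_pos.2 hc).le
      rwa [smul_smul, inv_mul_cancel₀ hc.ne', one_smul] at this
    have := smul_le_smul_of_nonneg_left h hc.le
    rwa [smul_smul, mul_inv_cancel₀ hc.ne', one_smul] at this

/-- The sublinear map `w ↦ inf_{t ≥ 0} (p (w + t v) - t p v)`. -/
theorem exists_shift (hG : CodirectedComplete G) (hp : IsSublinear p) (v : V) :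
    ∃ P : V → G, IsSublinear P ∧ (∀ w, P w ≤ p w) ∧ ∀ w, P w ≤ p (w + v) - p v := by
  let A : V → Set G := fun w => (fun t : ℝ => p (w + t • v) - t • p v) '' Set.Ici 0
  have hA : ∀ w, ∃ g, IsGLB (A w) g := fun w => by
    refine hG _ (Set.nonempty_Ici.image _) ?_ ⟨-p (-w), ?_⟩
    -- The family decreases in `t`, since `p ((t - s) • v) = (t - s) • p v` for `s < t`. Thus it is
    -- codirected.
    · have key : ∀ s t : ℝ, s ≤ t →
          p (w + t • v) - t • p v ≤ p (w + s • v) - s • p v := fun s t hst => by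
        rcases hst.eq_or_lt with rfl | hlt
        · exact le_rfl
        have h := hp.add_le (w + s • v) ((t - s) • v)
        rw [hp.smul_eq (sub_pos.2 hlt), add_assoc, ← add_smul, add_sub_cancel, sub_smul] at h
        rw [sub_le_iff_le_add]
        refine h.trans (le_of_eq ?_)
        abel
      rintro _ ⟨s, hs, rfl⟩ _ ⟨t, ht, rfl⟩
      exact ⟨_, ⟨max s t, Set.mem_Ici.2 (le_max_of_le_left hs), rfl⟩, key _ _ (le_max_left _ _),
        key _ _ (le_max_right _ _)⟩
    · rintro _ ⟨t, ht, rfl⟩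
      have h0 : t • p v ≤ p (t • v) := by
        rcases (Set.mem_Ici.1 ht).eq_or_lt with rfl | hlt
        · simpa using hp.zero_nonneg
        · exact (hp.smul_eq hlt v).ge
      have h := h0.trans ((congrArg p (by abel : t • v = (w + t • v) + -w)).le.trans (hp.add_le _ _))
      change -p (-w) ≤ p (w + t • v) - t • p v
      rw [le_sub_iff_add_le, neg_add_le_iff_le_add, add_comm]
      exact h
  choose P hP using hA
  refine ⟨P, of_isGLB hP ?_ ?_, fun w => ?_, fun w => ?_⟩
  · rintro w₁ w₂ _ ⟨s, hs, rfl⟩ _ ⟨t, ht, rfl⟩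
    refine ⟨_, ⟨s + t, Set.mem_Ici.2 (add_nonneg hs ht), rfl⟩, ?_⟩
    have h := hp.add_le (w₁ + s • v) (w₂ + t • v)
    rw [show w₁ + s • v + (w₂ + t • v) = w₁ + w₂ + (s + t) • v by rw [add_smul]; abel] at h
    refine (sub_le_sub_right h _).trans (le_of_eq ?_)
    change _ = p (w₁ + s • v) - s • p v + (p (w₂ + t • v) - t • p v)
    rw [add_smul, add_sub_add_comm]
  · rintro c w hc _ ⟨t, ht, rfl⟩
    refine ⟨_, ⟨c * t, Set.mem_Ici.2 (mul_nonneg hc.le ht), rfl⟩, le_of_eq ?_⟩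
    change p (c • w + (c * t) • v) - (c * t) • p v = c • (p (w + t • v) - t • p v)
    rw [smul_sub, ← hp.smul_eq hc, smul_add, smul_smul, smul_smul]
  · exact (hP w).1 ⟨0, Set.self_mem_Ici, by simp⟩
  · exact (hP w).1 ⟨1, Set.mem_Ici.2 zero_le_one, by simp⟩

/-- A minimal sublinear map below a given one. -/
theorem exists_minimal (hG : CodirectedComplete G) (hp : IsSublinear p) :
    ∃ P : V → G, IsSublinear P ∧ P ≤ p ∧ ∀ P', IsSublinear P' → P' ≤ P → P' = P := by
  -- The order dual turns the maximal element of Zorn's lemma into a minimal one. A chain is bounded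
  -- by its pointwise infimum.
  let S : Set (V → G)ᵒᵈ := {P | IsSublinear (OrderDual.ofDual P) ∧ OrderDual.ofDual P ≤ p}
  obtain ⟨P, -, hP⟩ := zorn_le_nonempty₀ S (fun c hcS hc y hy => by
    let A : V → Set G := fun v => (fun P : (V → G)ᵒᵈ => OrderDual.ofDual P v) '' c
    have hA : ∀ v, ∃ g, IsGLB (A v) g := fun v => by
      refine hG _ ⟨_, y, hy, rfl⟩ ?_ ⟨-p (-v), ?_⟩
      · rintro _ ⟨P, hP, rfl⟩ _ ⟨P', hP', rfl⟩
        rcases hc.total hP hP' with h | h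
        · exact ⟨_, ⟨P', hP', rfl⟩, h v, le_rfl⟩
        · exact ⟨_, ⟨P, hP, rfl⟩, le_rfl, h v⟩
      · rintro _ ⟨P, hP, rfl⟩
        exact (neg_le_neg ((hcS hP).2 (-v))).trans ((hcS hP).1.neg_le v)
    choose P hP using hA
    refine ⟨OrderDual.toDual P, ⟨of_isGLB hP ?_ ?_, fun v => ?_⟩, fun P' hP' v => ?_⟩
    · rintro v w _ ⟨P, hP, rfl⟩ _ ⟨P', hP', rfl⟩
      rcases hc.total hP hP' with h | h
      · exact ⟨_, ⟨P', hP', rfl⟩, ((hcS hP').1.add_le v w).trans (add_le_add_left (h v) _)⟩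
      · exact ⟨_, ⟨P, hP, rfl⟩, ((hcS hP).1.add_le v w).trans (add_le_add_right (h w) _)⟩
    · rintro c v hc _ ⟨P, hP, rfl⟩
      exact ⟨_, ⟨P, hP, rfl⟩, (hcS hP).1.smul_le c v hc⟩
    · exact ((hP v).1 ⟨y, hy, rfl⟩).trans ((hcS hy).2 v)
    · exact (hP v).1 ⟨P', hP', rfl⟩) (OrderDual.toDual p) ⟨hp, le_rfl⟩
  refine ⟨OrderDual.ofDual P, hP.1.1, hP.1.2, fun P' hP' hle => hle.antisymm ?_⟩
  exact hP.2 (y := OrderDual.toDual P') ⟨hP', hle.trans hP.1.2⟩ hle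

/-- The **Hahn–Banach–Kantorovich theorem**: a sublinear map into an order complete vector space
dominates a linear map that agrees with it at a given vector. -/
theorem exists_linearMap_le (hG : CodirectedComplete G) (hp : IsSublinear p) (v₀ : V) :
    ∃ φ : V →ₗ[ℝ] G, (∀ v, φ v ≤ p v) ∧ φ v₀ = p v₀ := by
  -- Anything below the shift at `v₀` is at most `p 0 - p v₀` at `-v₀`. For a linear map this forces
  -- the value `p v₀` at `v₀`.
  obtain ⟨p₀, hp₀, hle₀, hv₀⟩ := hp.exists_shift hG v₀
  obtain ⟨P, hP, hPle, hmin⟩ := hp₀.exists_minimal hG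
  have hadd : ∀ v w, P (v + w) = P v + P w := fun v w => by
    refine (hP.add_le v w).antisymm ?_
    -- By minimality the shift of `P` at `w` is `P` itself, so its second bound reads `P v ≤ P (v +
    -- w) - P w`, which is superadditivity.
    obtain ⟨P', hP', hle, hv⟩ := hP.exists_shift hG w
    have h := hv v
    rw [hmin P' hP' hle] at h
    exact le_sub_iff_add_le.1 h
  have hzero : P 0 = 0 := by simpa using hadd 0 0
  have hneg : ∀ v, P (-v) = -P v := fun v => by
    rw [eq_neg_iff_add_eq_zero, ← hadd, neg_add_cancel, hzero]
  refine ⟨{ toFun := P, map_add' := hadd, map_smul' := fun c v => ?_ }, fun v => ?_, ?_⟩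
  · rcases lt_trichotomy c 0 with hc | rfl | hc
    · have h := hP.smul_eq (neg_pos.2 hc) v
      rw [neg_smul, neg_smul, hneg] at h
      exact neg_injective h
    · simpa using hzero
    · exact hP.smul_eq hc v
  · exact (hPle v).trans (hle₀ v)
  · refine ((hPle v₀).trans (hle₀ v₀)).antisymm ?_
    have h := (hPle (-v₀)).trans (hv₀ (-v₀))
    rw [hneg, neg_add_cancel] at h
    have hp0 : p 0 ≤ 0 := by
      have := hp.smul_eq two_pos (0 : V)
      rw [smul_zero, two_smul] at this
      exact (left_eq_add.1 this).le
    have := h.trans (sub_le_sub_right hp0 _)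
    rw [zero_sub] at this
    exact neg_le_neg_iff.1 this

end IsSublinear

end HahnBanach

/-! ## Order and distance on `L⁰(μ)` -/

namespace L0

section
variable {X : Type u} [MeasurableSpace X] {μ : Measure X}

theorem coeFn_of (F : X → ℝ) (hF : Measurable F) : of μ F hF =ᵐ[μ] F :=
  AEEqFun.coeFn_mk F hF.aestronglyMeasurable

theorem coeFn_zero : (0 : L0 μ) =ᵐ[μ] (0 : X → ℝ) := AEEqFun.coeFn_zero
theorem coeFn_one : (1 : L0 μ) =ᵐ[μ] (1 : X → ℝ) := AEEqFun.coeFn_one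
theorem coeFn_add (f g : L0 μ) : ⇑(f + g) =ᵐ[μ] f + g := AEEqFun.coeFn_add f g
theorem coeFn_sub (f g : L0 μ) : ⇑(f - g) =ᵐ[μ] f - g := AEEqFun.coeFn_sub f g
theorem coeFn_mul (f g : L0 μ) : ⇑(f * g) =ᵐ[μ] f * g := AEEqFun.coeFn_mul f g
theorem coeFn_smul (c : ℝ) (f : L0 μ) : ⇑(c • f) =ᵐ[μ] c • ⇑f := AEEqFun.coeFn_smul c f
theorem coeFn_abs (f : L0 μ) : ⇑|f| =ᵐ[μ] fun x => |f x| := AEEqFun.coeFn_abs f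

theorem measurable_coe (f : L0 μ) : Measurable f := f.stronglyMeasurable.measurable

theorem le_def {f g : L0 μ} : f ≤ g ↔ ∀ᵐ x ∂μ, f x ≤ g x := AEEqFun.coeFn_le.symm

theorem eq_iff_ae {f g : L0 μ} : f = g ↔ ∀ᵐ x ∂μ, f x = g x := AEEqFun.ext_iff

instance instIsOrderedRing : IsOrderedRing (L0 μ) where
  add_le_add_left a b h c := by
    rw [le_def] at h ⊢
    filter_upwards [h, coeFn_add a c, coeFn_add b c] with x h h₁ h₂
    rw [h₁, h₂]
    exact add_le_add_left h _
  zero_le_one := by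
    rw [le_def]
    filter_upwards [coeFn_zero (μ := μ), coeFn_one (μ := μ)] with x h₁ h₂
    rw [h₁, h₂]
    exact zero_le_one
  mul_le_mul_of_nonneg_left a ha b c h := by
    rw [le_def] at h ha ⊢
    filter_upwards [h, ha, coeFn_zero (μ := μ), coeFn_mul a b, coeFn_mul a c] with x h ha h₀ h₁ h₂
    rw [h₁, h₂]
    exact mul_le_mul_of_nonneg_left h (h₀.symm.le.trans ha)
  mul_le_mul_of_nonneg_right a ha b c h := by
    rw [le_def] at h ha ⊢
    filter_upwards [h, ha, coeFn_zero (μ := μ), coeFn_mul b a, coeFn_mul c a] with x h ha h₀ h₁ h₂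
    rw [h₁, h₂]
    exact mul_le_mul_of_nonneg_right h (h₀.symm.le.trans ha)

instance instIsOrderedAddMonoid : IsOrderedAddMonoid (L0 μ) :=
  IsOrderedRing.toIsOrderedAddMonoid

instance instPosSMulMono : PosSMulMono ℝ (L0 μ) where
  smul_le_smul_of_nonneg_left c hc f g h := by
    rw [le_def] at h ⊢
    filter_upwards [h, coeFn_smul c f, coeFn_smul c g] with x h h₁ h₂
    rw [h₁, h₂]
    exact mul_le_mul_of_nonneg_left h hc

/-! ### The reference measure, convergence in distance, order completeness -/

section RefMeasure
variable [SigmaFinite μ]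

instance instIsFiniteMeasureRefMeasure : IsFiniteMeasure (refMeasure μ) :=
  (exists_refMeasure μ).choose_spec.1

theorem absolutelyContinuous_refMeasure : μ ≪ refMeasure μ :=
  (exists_refMeasure μ).choose_spec.2.1

theorem refMeasure_absolutelyContinuous : refMeasure μ ≪ μ :=
  Measure.absolutelyContinuous_of_le (exists_refMeasure μ).choose_spec.2.2.1

theorem ae_refMeasure {p : X → Prop} : (∀ᵐ x ∂(refMeasure μ), p x) ↔ ∀ᵐ x ∂μ, p x :=
  ⟨fun h => absolutelyContinuous_refMeasure.ae_le h, fun h => refMeasure_absolutelyContinuous.ae_le h⟩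

theorem integrable_min_one (F : X → ℝ) (hF : Measurable F) :
    Integrable (fun x => min |F x| 1) (refMeasure μ) := by
  refine Integrable.of_bound (hF.abs.min measurable_const).aestronglyMeasurable 1
    (Eventually.of_forall fun x => ?_)
  rw [Real.norm_eq_abs, abs_of_nonneg (le_min (abs_nonneg _) zero_le_one)]
  exact min_le_right _ _

theorem dist_zero (f : L0 μ) : dist f 0 = ∫ x, min |f x| 1 ∂(refMeasure μ) := by
  refine integral_congr_ae ?_
  filter_upwards [ae_refMeasure.2 (coeFn_zero (μ := μ))] with x hx
  simp [hx]

theorem dist_self (f : L0 μ) : dist f f = 0 := by simp [dist]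

theorem dist_zero_nonneg (f : L0 μ) : 0 ≤ dist f 0 :=
  integral_nonneg fun _ => le_min (abs_nonneg _) zero_le_one

theorem dist_zero_mono {f g : L0 μ} (hf : 0 ≤ f) (h : f ≤ g) : dist f 0 ≤ dist g 0 := by
  rw [dist_zero, dist_zero]
  refine integral_mono_ae (integrable_min_one _ f.measurable_coe)
    (integrable_min_one _ g.measurable_coe) ?_
  filter_upwards [ae_refMeasure.2 (le_def.1 hf), ae_refMeasure.2 (le_def.1 h),
    ae_refMeasure.2 (coeFn_zero (μ := μ))] with x h₁ h₂ h₃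
  rw [h₃] at h₁
  exact min_le_min_right _ (abs_le_abs_of_nonneg h₁ h₂)

theorem dist_zero_add_le (f g : L0 μ) : dist (f + g) 0 ≤ dist f 0 + dist g 0 := by
  rw [dist_zero, dist_zero, dist_zero, ← integral_add (integrable_min_one _ f.measurable_coe)
    (integrable_min_one _ g.measurable_coe)]
  refine integral_mono_ae (integrable_min_one _ (f + g).measurable_coe)
    ((integrable_min_one _ f.measurable_coe).add (integrable_min_one _ g.measurable_coe)) ?_
  filter_upwards [ae_refMeasure.2 (coeFn_add f g)] with x hx
  change min |(f + g) x| 1 ≤ min |f x| 1 + min |g x| 1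
  rw [hx]
  have := abs_add_le (f x) (g x)
  have := abs_nonneg (f x)
  have := abs_nonneg (g x)
  change min |f x + g x| 1 ≤ _
  grind

theorem eq_zero_of_dist_zero {f : L0 μ} (h : dist f 0 = 0) : f = 0 := by
  rw [dist_zero, integral_eq_zero_iff_of_nonneg
    (fun _ => le_min (abs_nonneg _) zero_le_one) (integrable_min_one _ f.measurable_coe)] at h
  refine eq_iff_ae.2 ?_
  filter_upwards [ae_refMeasure.1 h, coeFn_zero (μ := μ)] with x hx h₀
  rw [h₀]
  have : min |f x| 1 = 0 := hx
  exact abs_eq_zero.1 (by grind)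

/-- Dominated convergence: the truncated integrands are at most `1`, which is integrable for the
finite reference measure. -/
theorem tendsto_dist_zero {f : ℕ → L0 μ} (h : ∀ᵐ x ∂μ, Tendsto (fun n => f n x) atTop (𝓝 0)) :
    Tendsto (fun n => dist (f n) 0) atTop (𝓝 0) := by
  simp only [dist_zero]
  have : (0 : ℝ) = ∫ x : X, (0 : ℝ) ∂(refMeasure μ) := by simp
  rw [this]
  refine tendsto_integral_of_dominated_convergence (fun _ => 1)
    (fun n => (integrable_min_one _ (f n).measurable_coe).aestronglyMeasurable)
    (integrable_const _) (fun n => Eventually.of_forall fun x => ?_) ?_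
  · rw [Real.norm_eq_abs, abs_of_nonneg (le_min (abs_nonneg _) zero_le_one)]
    exact min_le_right _ _
  · filter_upwards [ae_refMeasure.2 h] with x hx
    have := hx.abs.min (tendsto_const_nhds (x := (1 : ℝ)))
    simpa using this

/-- An element of `L⁰(μ)` that is dominated by arbitrarily small elements is nonpositive. -/
theorem le_of_forall_le_add {f g : L0 μ}
    (h : ∀ ε : ℝ, 0 < ε → ∃ k : L0 μ, f ≤ g + k ∧ 0 ≤ k ∧ dist k 0 < ε) : f ≤ g := by
  have h0 : (f - g) ⊔ 0 = 0 := by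
    refine eq_zero_of_dist_zero ((dist_zero_nonneg _).antisymm' (le_of_forall_pos_lt_add ?_))
    intro ε hε
    obtain ⟨k, hk, hk0, hkε⟩ := h ε hε
    rw [zero_add]
    exact (dist_zero_mono le_sup_right (sup_le (sub_le_iff_le_add'.2 hk) hk0)).trans_lt hkε
  exact sub_nonpos.1 (le_sup_left.trans h0.le)

/-- `L⁰(μ)` is order complete. -/
theorem codirectedComplete : CodirectedComplete (L0 μ) := by
  intro S hS hdir hbdd
  obtain ⟨b, hb⟩ := hbdd
  let ν := refMeasure μ
  -- The arctangent is bounded and strictly increasing. So `Ψ` is finite on all measurable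
  -- functions, and ordered functions with equal values agree a.e. The infimum is built from a
  -- sequence in `S` minimizing `Ψ`.
  let Ψ : (X → ℝ) → ℝ := fun f => ∫ x, Real.arctan (f x) ∂ν
  have hint : ∀ f : X → ℝ, AEMeasurable f ν → Integrable (fun x => Real.arctan (f x)) ν :=
    fun f hf => Integrable.of_bound
      (Real.continuous_arctan.measurable.comp_aemeasurable hf).aestronglyMeasurable (Real.pi / 2)
      (Eventually.of_forall fun x => abs_le.2
        ⟨(Real.neg_pi_div_two_lt_arctan _).le, (Real.arctan_lt_pi_div_two _).le⟩)
  have hmono : ∀ f g : X → ℝ, AEMeasurable f ν → AEMeasurable g ν → f ≤ᵐ[ν] g → Ψ f ≤ Ψ g :=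
    fun f g hf hg h => integral_mono_ae (hint f hf) (hint g hg)
      (h.mono fun x hx => Real.arctan_strictMono.monotone hx)
  have hbd : BddBelow ((fun f : L0 μ => Ψ f) '' S) := by
    refine ⟨Ψ b, ?_⟩
    rintro _ ⟨f, hf, rfl⟩
    exact hmono _ _ b.measurable_coe.aemeasurable f.measurable_coe.aemeasurable
      (ae_refMeasure.2 (le_def.1 (hb hf)))
  let I := sInf ((fun f : L0 μ => Ψ f) '' S)
  have hI : ∀ f ∈ S, I ≤ Ψ f := fun f hf => csInf_le hbd ⟨f, hf, rfl⟩
  have hex : ∀ n : ℕ, ∃ f ∈ S, Ψ f < I + 1 / (n + 1) := fun n => by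
    obtain ⟨_, ⟨f, hf, rfl⟩, h⟩ := exists_lt_of_csInf_lt (hS.image fun f : L0 μ => Ψ f)
      (lt_add_of_pos_right I (Nat.one_div_pos_of_nat (α := ℝ) (n := n)))
    exact ⟨f, hf, h⟩
  choose t htS ht using hex
  have hbt : ∀ᵐ x ∂μ, ∀ n, b x ≤ t n x := ae_all_iff.2 fun n => le_def.1 (hb (htS n))
  have hlow : ∀ s ∈ S, ∀ n, ∃ u ∈ S, u ≤ s ∧ ∀ i ≤ n, u ≤ t i := fun s hs n => by
    induction n with
    | zero =>
      obtain ⟨u, hu, h₁, h₂⟩ := hdir s hs (t 0) (htS 0)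
      exact ⟨u, hu, h₁, fun i hi => by rwa [Nat.le_zero.1 hi]⟩
    | succ n ih =>
      obtain ⟨u, hu, hus, hut⟩ := ih
      obtain ⟨u', hu', h₁, h₂⟩ := hdir u hu (t (n + 1)) (htS _)
      refine ⟨u', hu', le_trans h₁ hus, fun i hi => ?_⟩
      rcases Nat.le_succ_iff.1 hi with h | rfl
      · exact le_trans h₁ (hut i h)
      · exact h₂
  let G : X → ℝ := fun x => ⨅ n, t n x
  have hG : Measurable G := Measurable.iInf fun n => (t n).measurable_coe
  have hGle : ∀ᵐ x ∂μ, ∀ n, G x ≤ t n x := hbt.mono fun x hx n =>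
    ciInf_le ⟨b x, Set.forall_mem_range.2 hx⟩ n
  have hGI : Ψ G ≤ I := by
    refine le_of_forall_pos_le_add fun ε hε => ?_
    obtain ⟨n, hn⟩ := exists_nat_one_div_lt hε
    refine (hmono _ _ hG.aemeasurable (t n).measurable_coe.aemeasurable
      (ae_refMeasure.2 (hGle.mono fun x hx => hx n))).trans ?_
    exact (ht n).le.trans (add_le_add_right hn.le I)
  refine ⟨of μ G hG, fun s hs => ?_, fun c hc => le_def.2 ?_⟩
  · let D : ℕ → X → ℝ := fun n x => min (s x) ((Finset.range (n + 1)).inf' Finset.nonempty_range_add_one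
      fun i => t i x)
    have hDm : ∀ n, Measurable (D n) := fun n => by
      refine s.measurable_coe.min ?_
      have := Finset.inf'_induction (p := Measurable) (Finset.nonempty_range_add_one (n := n))
        (fun i => ⇑(t i)) (fun _ h₁ _ h₂ => h₁.inf h₂) (fun k _ => (t k).measurable_coe)
      convert this using 1
      ext x
      exact (Finset.inf'_apply _ _ _).symm
    -- `D n` itself need not lie in `S`, but codirectedness puts an element of `S` below it.
    have hDI : ∀ n, I ≤ Ψ (D n) := fun n => by
      obtain ⟨u, hu, hus, hut⟩ := hlow s hs n
      refine (hI u hu).trans (hmono _ _ u.measurable_coe.aemeasurable (hDm n).aemeasurable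
        (ae_refMeasure.2 ?_))
      have h : ∀ᵐ x ∂μ, ∀ i, i ≤ n → u x ≤ t i x :=
        ae_all_iff.2 fun i => eventually_imp_distrib_left.2 fun hi => le_def.1 (hut i hi)
      filter_upwards [h, le_def.1 hus] with x hx hx'
      exact le_min hx' (Finset.le_inf' _ _ fun i hi => hx i (Nat.lt_succ_iff.1 (Finset.mem_range.1 hi)))
    have hlim : Tendsto (fun n => Ψ (D n)) atTop (𝓝 (Ψ fun x => min (s x) (G x))) := by
      refine tendsto_integral_of_dominated_convergence (fun _ => Real.pi / 2)
        (fun n => (hint _ (hDm n).aemeasurable).aestronglyMeasurable) (integrable_const _)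
        (fun n => Eventually.of_forall fun x => abs_le.2
          ⟨(Real.neg_pi_div_two_lt_arctan _).le, (Real.arctan_lt_pi_div_two _).le⟩) ?_
      filter_upwards [ae_refMeasure.2 hbt] with x hx
      refine (Real.continuous_arctan.tendsto _).comp (tendsto_const_nhds.min ?_)
      have hmon : Antitone fun n : ℕ => (Finset.range (n + 1)).inf' Finset.nonempty_range_add_one
          fun i => t i x := fun n k hnk =>
        Finset.inf'_mono _ (Finset.range_mono (Nat.succ_le_succ hnk)) _
      have hbb : ∀ n : ℕ, b x ≤ (Finset.range (n + 1)).inf' Finset.nonempty_range_add_one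
          fun i => t i x := fun n => Finset.le_inf' _ _ fun i _ => hx i
      have := tendsto_atTop_ciInf hmon ⟨b x, Set.forall_mem_range.2 hbb⟩
      convert this using 2
      refine le_antisymm (le_ciInf fun n => Finset.le_inf' _ _ fun i _ =>
        ciInf_le ⟨b x, Set.forall_mem_range.2 hx⟩ i) (le_ciInf fun n => ?_)
      exact (ciInf_le ⟨b x, Set.forall_mem_range.2 hbb⟩ n).trans
        (Finset.inf'_le _ (Finset.self_mem_range_succ n))
    -- Replacing `G` by `min s G` cannot lower `Ψ` below `I`, while `Ψ G ≤ I`. Equality of the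
    -- integrals then gives `min s G = G` a.e.
    have hge : I ≤ Ψ fun x => min (s x) (G x) := ge_of_tendsto' hlim hDI
    have hmin : Measurable fun x => min (s x) (G x) := s.measurable_coe.min hG
    have hle : (fun x => Real.arctan (min (s x) (G x))) ≤ᵐ[ν] fun x => Real.arctan (G x) :=
      Eventually.of_forall fun x => Real.arctan_strictMono.monotone (min_le_right _ _)
    have heq := (integral_eq_iff_of_ae_le (hint _ hmin.aemeasurable) (hint _ hG.aemeasurable) hle).1
      ((integral_mono_ae (hint _ hmin.aemeasurable) (hint _ hG.aemeasurable) hle).antisymm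
        (hGI.trans hge))
    refine le_def.2 ?_
    filter_upwards [coeFn_of (μ := μ) G hG, ae_refMeasure.1 heq] with x h₁ h₂
    rw [h₁, ← Real.arctan_strictMono.injective h₂]
    exact min_le_left _ _
  · have h : ∀ᵐ x ∂μ, ∀ n, c x ≤ t n x := ae_all_iff.2 fun n => le_def.1 (hc (htS n))
    filter_upwards [h, coeFn_of (μ := μ) G hG] with x hx h₁
    rw [h₁]
    exact le_ciInf hx

end RefMeasure

end

end L0

/-! ## Locality of norm-decreasing maps -/

namespace L0

section
variable {X : Type u} [MeasurableSpace X] {μ : Measure X}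

theorem coeFn_ind (E : Set X) (hE : MeasurableSet E) :
    ind μ E hE =ᵐ[μ] E.indicator fun _ => 1 := coeFn_of _ _

theorem abs_mul_eq (f g : L0 μ) : |f * g| = |f| * |g| := by
  refine eq_iff_ae.2 ?_
  filter_upwards [coeFn_abs (f * g), coeFn_mul f g, coeFn_mul |f| |g|, coeFn_abs f, coeFn_abs g]
    with x h₁ h₂ h₃ h₄ h₅
  rw [h₁, h₂, h₃, Pi.mul_apply, Pi.mul_apply, h₄, h₅, abs_mul]

theorem ind_nonneg (E : Set X) (hE : MeasurableSet E) : 0 ≤ ind μ E hE := by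
  refine le_def.2 ?_
  filter_upwards [coeFn_ind (μ := μ) E hE, coeFn_zero (μ := μ)] with x h₁ h₂
  rw [h₁, h₂]
  exact Set.indicator_nonneg (fun _ _ => zero_le_one) x

theorem abs_ind (E : Set X) (hE : MeasurableSet E) : |ind μ E hE| = ind μ E hE :=
  abs_of_nonneg (ind_nonneg E hE)

theorem ind_add_ind_compl (E : Set X) (hE : MeasurableSet E) :
    ind μ E hE + ind μ Eᶜ hE.compl = 1 := by
  refine eq_iff_ae.2 ?_
  filter_upwards [coeFn_add (ind μ E hE) (ind μ Eᶜ hE.compl), coeFn_ind (μ := μ) E hE,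
    coeFn_ind (μ := μ) Eᶜ hE.compl, coeFn_one (μ := μ)] with x h₁ h₂ h₃ h₄
  rw [h₁, Pi.add_apply, h₂, h₃, h₄]
  by_cases hx : x ∈ E <;> simp [hx]

theorem ind_mul_ind_of_disjoint {E F : Set X} (hE : MeasurableSet E) (hF : MeasurableSet F)
    (h : Disjoint E F) : ind μ E hE * ind μ F hF = 0 := by
  refine eq_iff_ae.2 ?_
  filter_upwards [coeFn_mul (ind μ E hE) (ind μ F hF), coeFn_ind (μ := μ) E hE,
    coeFn_ind (μ := μ) F hF, coeFn_zero (μ := μ)] with x h₁ h₂ h₃ h₄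
  rw [h₁, Pi.mul_apply, h₂, h₃, h₄]
  by_cases hx : x ∈ E
  · simp [hx, Set.disjoint_left.1 h hx]
  · simp [hx]

theorem of_smul (c : ℝ) (F : X → ℝ) (hF : Measurable F) :
    of μ (c • F) (hF.const_smul c) = c • of μ F hF := rfl

theorem of_eq_of_ae {F G : X → ℝ} (hF : Measurable F) (hG : Measurable G) (h : F =ᵐ[μ] G) :
    of μ F hF = of μ G hG := AEEqFun.mk_eq_mk.2 h

end

end L0

namespace L0BanachModule

section
variable {X : Type u} [MeasurableSpace X] {μ : Measure X} [SigmaFinite μ]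
  (M : L0BanachModule.{u, w} μ)

theorem pnorm_neg (v : M.carrier) : M.pnorm (-v) = M.pnorm v := by
  simpa using M.pnorm_real_smul (-1) v

theorem pnorm_sub_comm (v w : M.carrier) : M.pnorm (v - w) = M.pnorm (w - v) := by
  rw [← M.pnorm_neg, neg_sub]

theorem pnorm_sub_le (v w z : M.carrier) :
    M.pnorm (v - z) ≤ M.pnorm (v - w) + M.pnorm (w - z) := by
  have := M.pnorm_add_le (v - w) (w - z)
  rwa [sub_add_sub_cancel] at this

theorem pnorm_le_add_sub (v w : M.carrier) : M.pnorm v ≤ M.pnorm w + M.pnorm (v - w) := by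
  have := M.pnorm_add_le w (v - w)
  rwa [add_sub_cancel] at this

theorem pnorm_zero : M.pnorm 0 = 0 := (M.pnorm_eq_zero 0).2 rfl

theorem dist_comm (v w : M.carrier) : M.dist v w = M.dist w v := by
  rw [dist, dist, M.pnorm_sub_comm]

theorem dist_triangle (v w z : M.carrier) : M.dist v z ≤ M.dist v w + M.dist w z :=
  (L0.dist_zero_mono (M.pnorm_nonneg _) (M.pnorm_sub_le v w z)).trans (L0.dist_zero_add_le _ _)

theorem eq_of_dist_eq_zero {v w : M.carrier} (h : M.dist v w = 0) : v = w :=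
  sub_eq_zero.1 ((M.pnorm_eq_zero _).1 (L0.eq_zero_of_dist_zero h))

variable {N : Type*} [AddCommGroup N] [Module (L0 μ) N] [Module ℝ N] [IsScalarTower ℝ (L0 μ) N]

/-- A real-linear map that does not increase the pointwise norm is `L⁰(μ)`-linear. -/
theorem map_smul_of_pnorm_le (nrm : N → L0 μ) (hnn : ∀ y, 0 ≤ nrm y) (h0 : ∀ y, nrm y = 0 → y = 0)
    (hadd : ∀ y z, nrm (y + z) ≤ nrm y + nrm z) (hsmul : ∀ (f : L0 μ) y, nrm (f • y) = |f| * nrm y)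
    (T : M.carrier →ₗ[ℝ] N) (hT : ∀ v, nrm (T v) ≤ M.pnorm v) (f : L0 μ) (v : M.carrier) :
    T (f • v) = f • T v := by
  -- Locality: `|1_E T (1_F v)| ≤ 1_E 1_F |v| = 0` for disjoint `E` and `F`. Splitting along a set
  -- and its complement then lets `T` commute with indicators.
  have hvanish : ∀ (E F : Set X) (hE : MeasurableSet E) (hF : MeasurableSet F), Disjoint E F →
      ∀ v, L0.ind μ E hE • T (L0.ind μ F hF • v) = 0 := fun E F hE hF hEF v => by
    refine h0 _ ((hnn _).antisymm' ?_)
    rw [hsmul, L0.abs_ind]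
    refine (mul_le_mul_of_nonneg_left (hT _) (L0.ind_nonneg E hE)).trans (le_of_eq ?_)
    rw [M.pnorm_smul, L0.abs_ind, ← mul_assoc, L0.ind_mul_ind_of_disjoint hE hF hEF, zero_mul]
  have hind : ∀ (E : Set X) (hE : MeasurableSet E) v,
      T (L0.ind μ E hE • v) = L0.ind μ E hE • T v := fun E hE v => by
    have h₁ : T (L0.ind μ E hE • v) = L0.ind μ E hE • T (L0.ind μ E hE • v) := by
      have h := add_smul (L0.ind μ E hE) (L0.ind μ Eᶜ hE.compl) (T (L0.ind μ E hE • v))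
      rwa [L0.ind_add_ind_compl, one_smul, hvanish _ _ _ _ disjoint_compl_left, add_zero] at h
    have h₂ := congrArg T (add_smul (L0.ind μ E hE) (L0.ind μ Eᶜ hE.compl) v)
    rw [L0.ind_add_ind_compl, one_smul, map_add] at h₂
    rw [h₁, h₂, smul_add, hvanish _ _ _ _ disjoint_compl_right, add_zero]
  have hsimple : ∀ (s : SimpleFunc X ℝ) v,
      T (L0.of μ s s.measurable • v) = L0.of μ s s.measurable • T v := fun s => by
    induction s using SimpleFunc.induction with
    | const c hE =>
      rename_i E
      intro v
      have h : L0.of μ _ (SimpleFunc.piecewise E hE (SimpleFunc.const X c)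
          (SimpleFunc.const X 0)).measurable = c • L0.ind μ E hE := by
        refine (L0.of_eq_of_ae _ ((measurable_const.indicator hE).const_smul c)
          (Eventually.of_forall fun x => ?_)).trans (L0.of_smul c _ _)
        by_cases hx : x ∈ E <;> simp [hx]
      rw [h, smul_assoc, map_smul, hind, _root_.smul_assoc]
    | add _ hf hg =>
      rename_i f g _
      intro v
      change T ((L0.of μ f f.measurable + L0.of μ g g.measurable) • v) =
        (L0.of μ f f.measurable + L0.of μ g g.measurable) • T v
      rw [add_smul, add_smul, map_add, hf, hg]
  let s : ℕ → L0 μ := fun n => L0.of μ (f.stronglyMeasurable.approx n)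
    (f.stronglyMeasurable.approx n).measurable
  -- Linearity over simple functions leaves only errors in `f - s n`, one for each side. The summand
  -- `0` matches the form of `L0.le_of_forall_le_add`.
  have hle : ∀ n, nrm (T (f • v) - f • T v) ≤ 0 + 2 * (|f - s n| * M.pnorm v) := fun n => by
    have h : T (f • v) - f • T v = T ((f - s n) • v) + (s n - f) • T v := by
      rw [sub_smul, sub_smul, map_sub, hsimple]
      abel
    rw [h, zero_add, two_mul]
    refine (hadd _ _).trans (add_le_add ((hT _).trans (M.pnorm_smul _ _).le) ?_)
    rw [hsmul, abs_sub_comm]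
    exact mul_le_mul_of_nonneg_left (hT v) (abs_nonneg _)
  have hlim : Tendsto (fun n => L0.dist (2 * (|f - s n| * M.pnorm v)) 0) atTop (𝓝 0) := by
    refine L0.tendsto_dist_zero ?_
    have h : ∀ᵐ x ∂μ, ∀ n, (2 * (|f - s n| * M.pnorm v) : L0 μ) x =
        2 * (|f x - f.stronglyMeasurable.approx n x| * M.pnorm v x) := ae_all_iff.2 fun n => by
      rw [two_mul]
      filter_upwards [L0.coeFn_add (|f - s n| * M.pnorm v) (|f - s n| * M.pnorm v),
        L0.coeFn_mul |f - s n| (M.pnorm v), L0.coeFn_abs (f - s n), L0.coeFn_sub f (s n),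
        L0.coeFn_of (μ := μ) _ (f.stronglyMeasurable.approx n).measurable] with x h₁ h₂ h₃ h₄ h₅
      rw [h₁, Pi.add_apply, h₂, Pi.mul_apply, h₃, h₄, Pi.sub_apply, h₅, two_mul]
    filter_upwards [h] with x hx
    simp only [hx]
    have := (((tendsto_const_nhds (x := f x)).sub
      (f.stronglyMeasurable.tendsto_approx x)).abs.mul_const (M.pnorm v x)).const_mul 2
    simpa using this
  refine sub_eq_zero.1 (h0 _ ((hnn _).antisymm' (L0.le_of_forall_le_add fun ε hε => ?_)))
  obtain ⟨n, hn⟩ := (hlim.eventually (gt_mem_nhds hε)).exists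
  refine ⟨_, hle n, ?_, hn⟩
  exact mul_nonneg zero_le_two (mul_nonneg (abs_nonneg _) (M.pnorm_nonneg v))

end

end L0BanachModule

/-! ## Norming functionals -/

namespace L0BanachModule

section
variable {X : Type u} [MeasurableSpace X] {μ : Measure X} [SigmaFinite μ]
  (M : L0BanachModule.{u, w} μ)

theorem isSublinear_pnorm : IsSublinear M.pnorm where
  add_le := M.pnorm_add_le
  smul_le c v hc := by rw [M.pnorm_real_smul, abs_of_pos hc]

/-- Every vector is normed by a functional of norm at most one. -/
theorem exists_norming_functional (v₀ : M.carrier) :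
    ∃ φ : M.carrier →ₗ[L0 μ] L0 μ, (∀ v, |φ v| ≤ M.pnorm v) ∧ φ v₀ = M.pnorm v₀ := by
  obtain ⟨φ, hle, hφ⟩ := M.isSublinear_pnorm.exists_linearMap_le L0.codirectedComplete v₀
  have habs : ∀ v, |φ v| ≤ M.pnorm v := fun v => by
    refine abs_le'.2 ⟨hle v, ?_⟩
    rw [← map_neg, ← M.pnorm_neg]
    exact hle _
  refine ⟨{ φ with map_smul' := fun f v => ?_ }, habs, hφ⟩
  -- Here the target is `L⁰(μ)` over itself, with the absolute value as norm.
  refine M.map_smul_of_pnorm_le (N := L0 μ) (fun y => |y|) abs_nonneg (fun y hy => ?_) abs_add_le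
    (fun f y => L0.abs_mul_eq f y) φ habs f v
  exact ((le_abs_self y).trans hy.le).antisymm (neg_nonpos.1 ((neg_le_abs y).trans hy.le))

/-- A countably generated module has a norming sequence of functionals. -/
theorem CountablyGenerated.exists_norming_sequence {M : L0BanachModule.{u, w} μ}
    (hM : M.CountablyGenerated) : ∃ φ : ℕ → M.carrier →ₗ[L0 μ] L0 μ,
      ∀ v, IsLUB (Set.range fun n => |φ n v|) (M.pnorm v) := by
  obtain ⟨C, hC, hgen⟩ := hM
  have := hC.to_subtype
  let T : (C →₀ ℚ) → M.carrier := fun a => a.sum fun c r => (r : ℝ) • (c : M.carrier)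
  have hTadd : ∀ a b, T (a + b) = T a + T b := fun a b =>
    Finsupp.sum_add_index' (fun _ => by simp) fun c r s => by rw [Rat.cast_add, add_smul]
  have hTsmul : ∀ (r : ℚ) a, T (r • a) = (r : ℝ) • T a := fun r a => by
    refine (Finsupp.sum_smul_index fun _ => by simp).trans ?_
    rw [Finsupp.smul_sum]
    exact Finsupp.sum_congr fun c _ => by rw [Rat.cast_mul, mul_smul]
  obtain ⟨e, he⟩ := exists_surjective_nat (C →₀ ℚ)
  choose φ hφle hφ using fun n => M.exists_norming_functional (T (e n))
  refine ⟨φ, fun v => ⟨Set.forall_mem_range.2 fun n => hφle n v, fun u hu => ?_⟩⟩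
  replace hu : ∀ n, |φ n v| ≤ u := fun n => hu ⟨n, rfl⟩
  -- `P v` is the nontrivial half of the claim: no upper bound of the `|φ n v|` lies short of `|v|`.
  let P : M.carrier → Prop := fun v => ∀ u : L0 μ, (∀ n, |φ n v| ≤ u) → M.pnorm v ≤ u
  have hPT : ∀ a, P (T a) := fun a u hu => by
    obtain ⟨n, rfl⟩ := he a
    rw [← hφ n]
    exact (le_abs_self _).trans (hu n)
  -- If `u` bounds all `|φ n v|`, then `u + |v - g|` bounds all `|φ n g|`. Hence `|v| ≤ u + 2 |v -
  -- g|`.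
  have hPclosed : ∀ v, (∀ ε : ℝ, 0 < ε → ∃ g, P g ∧ M.dist v g < ε) → P v := fun v hv u hu => by
    refine L0.le_of_forall_le_add fun ε hε => ?_
    obtain ⟨g, hg, hd⟩ := hv (ε / 2) (half_pos hε)
    refine ⟨M.pnorm (v - g) + M.pnorm (v - g), ?_, add_nonneg (M.pnorm_nonneg _)
      (M.pnorm_nonneg _), (L0.dist_zero_add_le _ _).trans_lt (by
        change M.dist v g + M.dist v g < ε
        linarith)⟩
    rw [← add_assoc]
    refine (M.pnorm_le_add_sub v g).trans (add_le_add_left (hg _ fun n => ?_) _)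
    have h : φ n g = φ n v + φ n (g - v) := by rw [← map_add, add_sub_cancel]
    rw [h]
    refine (abs_add_le _ _).trans (add_le_add (hu n) ?_)
    rw [M.pnorm_sub_comm]
    exact hφle n _
  -- The error is measured by real multiples of one fixed `h`, because such order bounds pass
  -- directly through sums and real multiples. Convergence in distance follows from `ε • h` with `ε
  -- → 0`.
  have happrox : ∀ a ∈ Submodule.span ℝ C, ∃ h : L0 μ, 0 ≤ h ∧
      ∀ ε : ℝ, 0 < ε → ∃ b, M.pnorm (a - T b) ≤ ε • h := fun a ha => by
    induction ha using Submodule.span_induction with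
    | mem c hc =>
      refine ⟨0, le_rfl, fun ε _ => ⟨Finsupp.single ⟨c, hc⟩ 1, ?_⟩⟩
      have : T (Finsupp.single ⟨c, hc⟩ 1) = c := by
        change Finsupp.sum _ _ = _
        rw [Finsupp.sum_single_index (by simp), Rat.cast_one, one_smul]
      rw [this, sub_self, M.pnorm_zero, smul_zero]
    | zero =>
      refine ⟨0, le_rfl, fun ε _ => ⟨0, ?_⟩⟩
      have : T 0 = 0 := Finsupp.sum_zero_index
      rw [this, sub_self, M.pnorm_zero, smul_zero]
    | add x y _ _ hx hy =>
      obtain ⟨h, hh, hx⟩ := hx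
      obtain ⟨k, hk, hy⟩ := hy
      refine ⟨h + k, add_nonneg hh hk, fun ε hε => ?_⟩
      obtain ⟨b, hb⟩ := hx ε hε
      obtain ⟨d, hd⟩ := hy ε hε
      refine ⟨b + d, ?_⟩
      rw [hTadd, add_sub_add_comm, smul_add]
      exact (M.pnorm_add_le _ _).trans (add_le_add hb hd)
    | smul r x _ hx =>
      obtain ⟨h, hh, hx⟩ := hx
      refine ⟨M.pnorm x + (|r| + 1) • h, add_nonneg (M.pnorm_nonneg _)
        (smul_nonneg (by positivity) hh), fun ε hε => ?_⟩
      obtain ⟨b, hb⟩ := hx ε hε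
      -- The bound by `ε` controls `(r - q) • x`. The bound by `1` gives `|q| ≤ |r| + 1`, so that
      -- `h` can be chosen independently of `ε`.
      obtain ⟨q, hq₁, hq₂⟩ := exists_rat_btwn (show r < r + min ε 1 by simp [hε])
      have hrq : |r - q| ≤ min ε 1 := by
        rw [abs_le]
        constructor <;> linarith [lt_min hε one_pos]
      refine ⟨q • b, ?_⟩
      have hsplit : r • x - T (q • b) = (r - q) • x + (q : ℝ) • (x - T b) := by
        rw [hTsmul, sub_smul, smul_sub]
        abel
      rw [hsplit, smul_add]
      refine (M.pnorm_add_le _ _).trans (add_le_add ?_ ?_)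
      · rw [M.pnorm_real_smul]
        exact smul_le_smul_of_nonneg_right (hrq.trans (min_le_left _ _)) (M.pnorm_nonneg x)
      · rw [M.pnorm_real_smul]
        have hq : |(q : ℝ)| ≤ |r| + 1 := by
          have h₁ := abs_sub_abs_le_abs_sub (q : ℝ) r
          rw [abs_sub_comm] at h₁
          linarith [hrq.trans (min_le_right _ _)]
        refine (smul_le_smul_of_nonneg_left hb (abs_nonneg _)).trans ?_
        rw [smul_comm ε]
        exact smul_le_smul_of_nonneg_right hq (smul_nonneg hε.le hh)
  have hPspan : ∀ a ∈ Submodule.span ℝ C, P a := fun a ha => by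
    obtain ⟨h, hh, hb⟩ := happrox a ha
    refine hPclosed a fun ε hε => ?_
    have hlim : Tendsto (fun n : ℕ => L0.dist ((1 / ((n : ℝ) + 1)) • h) 0) atTop (𝓝 0) := by
      refine L0.tendsto_dist_zero ?_
      have : ∀ᵐ x ∂μ, ∀ n : ℕ, ((1 / ((n : ℝ) + 1)) • h : L0 μ) x = 1 / ((n : ℝ) + 1) * h x :=
        ae_all_iff.2 fun n => L0.coeFn_smul _ _
      filter_upwards [this] with x hx
      simp only [hx]
      simpa using (tendsto_one_div_add_atTop_nhds_zero_nat (𝕜 := ℝ)).mul_const (h x)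
    obtain ⟨n, hn⟩ := (hlim.eventually (gt_mem_nhds hε)).exists
    obtain ⟨b, hb⟩ := hb (1 / ((n : ℝ) + 1)) Nat.one_div_pos_of_nat
    exact ⟨T b, hPT b, (L0.dist_zero_mono (M.pnorm_nonneg _) hb).trans_lt hn⟩
  refine hPclosed v (fun ε hε => ?_) u hu
  obtain ⟨g, ⟨E, hE, a, ha, hg⟩, hd⟩ := hgen v ε hε
  refine ⟨g, fun u hu => ?_, hd⟩
  have hloc : ∀ n, L0.ind μ (E n) (hE.measurableSet n) * M.pnorm g ≤
      L0.ind μ (E n) (hE.measurableSet n) * u := fun n => by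
    set i := L0.ind μ (E n) (hE.measurableSet n) with hi
    set i' := L0.ind μ (E n)ᶜ (hE.measurableSet n).compl with hi'
    have hii' : i + i' = 1 := L0.ind_add_ind_compl _ _
    have hi0 : 0 ≤ i := L0.ind_nonneg _ _
    have hi'0 : 0 ≤ i' := L0.ind_nonneg _ _
    have hiabs : |i| = i := L0.abs_ind _ _
    have hmul : i * i' = 0 := L0.ind_mul_ind_of_disjoint _ _ disjoint_compl_right
    have hidem : i * i = i := by
      have := congrArg (i * ·) hii'
      simpa [mul_add, hmul] using this
    have hgn : i * M.pnorm g = i * M.pnorm (a n) := by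
      have := congrArg M.pnorm (hg n)
      rwa [M.pnorm_smul, M.pnorm_smul, hiabs] at this
    -- On `E n` the values `φ k (a n)` and `φ k g` coincide and are bounded by `u`; elsewhere only
    -- the trivial bound `|a n|` is used. Multiplying by the indicator discards that part.
    have key := hPspan (a n) (ha n) (i * u + i' * M.pnorm (a n)) fun k => by
      have h₁ : i * |φ k (a n)| = i * |φ k g| := by
        have := congrArg (fun z => |φ k z|) (hg n)
        simp only [map_smul, smul_eq_mul, L0.abs_mul_eq, ← hi, hiabs] at this
        exact this.symm
      have h₂ : |φ k (a n)| = i * |φ k (a n)| + i' * |φ k (a n)| := by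
        rw [← add_mul, hii', one_mul]
      rw [h₂, h₁]
      exact add_le_add (mul_le_mul_of_nonneg_left (hu k) hi0)
        (mul_le_mul_of_nonneg_left (hφle k _) hi'0)
    have := mul_le_mul_of_nonneg_left key hi0
    rwa [mul_add, ← mul_assoc, ← mul_assoc, hidem, hmul, zero_mul, add_zero, ← hgn] at this
  refine L0.le_def.2 ?_
  have h : ∀ᵐ x ∂μ, ∀ n, (E n).indicator (fun _ => (1 : ℝ)) x * M.pnorm g x ≤
      (E n).indicator (fun _ => (1 : ℝ)) x * u x := ae_all_iff.2 fun n => by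
    filter_upwards [L0.le_def.1 (hloc n), L0.coeFn_ind (μ := μ) (E n) (hE.measurableSet n),
      L0.coeFn_mul (L0.ind μ (E n) (hE.measurableSet n)) (M.pnorm g),
      L0.coeFn_mul (L0.ind μ (E n) (hE.measurableSet n)) u] with x h₁ h₂ h₃ h₄
    rwa [h₃, h₄, Pi.mul_apply, Pi.mul_apply, h₂] at h₁
  filter_upwards [h] with x hx
  obtain ⟨n, hn⟩ := Set.mem_iUnion.1 (hE.iUnion_eq.symm ▸ Set.mem_univ x)
  simpa [hn] using hx n

end

end L0BanachModule

/-! ## The module of a.e. bounded sequences in `L⁰(μ)` -/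

namespace L0

section
variable {X : Type u} [MeasurableSpace X] {μ : Measure X}

/-- By Tonelli the truncated series `∑ min |h j x| 1` is finite almost everywhere. Its terms tend to
`0`, so the truncation is eventually inactive. -/
theorem ae_summable [SigmaFinite μ] {h : ℕ → L0 μ} (hs : Summable fun j => dist (h j) 0) :
    ∀ᵐ x ∂μ, Summable fun j => |h j x| := by
  have hlt : ∫⁻ x, ∑' j, ENNReal.ofReal (min |h j x| 1) ∂(refMeasure μ) ≠ ∞ := by
    rw [lintegral_tsum fun j =>
      ((h j).measurable_coe.abs.min measurable_const).ennreal_ofReal.aemeasurable]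
    have : ∀ j, ∫⁻ x, ENNReal.ofReal (min |h j x| 1) ∂(refMeasure μ) =
        ENNReal.ofReal (dist (h j) 0) := fun j => by
      rw [dist_zero, ofReal_integral_eq_lintegral_ofReal (integrable_min_one _ (h j).measurable_coe)
        (Eventually.of_forall fun x => le_min (abs_nonneg _) zero_le_one)]
    simp_rw [this]
    exact hs.tsum_ofReal_ne_top
  have hae := ae_lt_top (Measurable.tsum fun j =>
    ((h j).measurable_coe.abs.min measurable_const).ennreal_ofReal) hlt
  filter_upwards [ae_refMeasure.1 hae] with x hx
  have hsum := ENNReal.summable_toReal hx.ne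
  have hmin : ∀ j, (ENNReal.ofReal (min |h j x| 1)).toReal = min |h j x| 1 := fun j =>
    ENNReal.toReal_ofReal (le_min (abs_nonneg _) zero_le_one)
  simp only [hmin] at hsum
  refine hsum.congr_cofinite ?_
  rw [Nat.cofinite_eq_atTop]
  filter_upwards [hsum.tendsto_atTop_zero.eventually (gt_mem_nhds one_pos)] with j hj
  grind

/-- The pointwise supremum of the absolute values of a sequence. -/
noncomputable def supNorm (f : ℕ → L0 μ) : L0 μ :=
  of μ (fun x => ⨆ n, |f n x|) (Measurable.iSup fun n => (f n).measurable_coe.abs)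

theorem coeFn_supNorm (f : ℕ → L0 μ) : supNorm f =ᵐ[μ] fun x => ⨆ n, |f n x| := coeFn_of _ _

/-- The sequences in `L⁰(μ)` that are bounded at almost every point. -/
def boundedSequences (μ : Measure X) : Submodule (L0 μ) (ℕ → L0 μ) where
  carrier := {f | ∀ᵐ x ∂μ, BddAbove (Set.range fun n => |f n x|)}
  zero_mem' := by
    have h : ∀ᵐ x ∂μ, ∀ _ : ℕ, (0 : L0 μ) x = 0 := ae_all_iff.2 fun _ => coeFn_zero
    filter_upwards [h] with x hx
    refine ⟨0, Set.forall_mem_range.2 fun n => ?_⟩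
    change |(0 : L0 μ) x| ≤ 0
    rw [hx n, abs_zero]
  add_mem' := fun {f g} hf hg => by
    have h : ∀ᵐ x ∂μ, ∀ n, (f n + g n) x = f n x + g n x := ae_all_iff.2 fun n => coeFn_add _ _
    filter_upwards [hf, hg, h] with x ⟨a, ha⟩ ⟨b, hb⟩ hx
    refine ⟨a + b, Set.forall_mem_range.2 fun n => ?_⟩
    change |(f n + g n) x| ≤ _
    rw [hx n]
    exact (abs_add_le _ _).trans (add_le_add (ha ⟨n, rfl⟩) (hb ⟨n, rfl⟩))
  smul_mem' := fun c f hf => by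
    have h : ∀ᵐ x ∂μ, ∀ n, (c * f n) x = c x * f n x := ae_all_iff.2 fun n => coeFn_mul _ _
    filter_upwards [hf, h] with x ⟨a, ha⟩ hx
    refine ⟨|c x| * a, Set.forall_mem_range.2 fun n => ?_⟩
    change |(c * f n) x| ≤ _
    rw [hx n, abs_mul]
    exact mul_le_mul_of_nonneg_left (ha ⟨n, rfl⟩) (abs_nonneg _)

theorem mem_boundedSequences {f : ℕ → L0 μ} :
    f ∈ boundedSequences μ ↔ ∀ᵐ x ∂μ, BddAbove (Set.range fun n => |f n x|) := Iff.rfl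

theorem isLUB_supNorm {f : ℕ → L0 μ} (hf : f ∈ boundedSequences μ) :
    IsLUB (Set.range fun n => |f n|) (supNorm f) := by
  refine ⟨?_, fun u hu => le_def.2 ?_⟩
  · rintro _ ⟨n, rfl⟩
    refine le_def.2 ?_
    filter_upwards [hf, coeFn_supNorm f, coeFn_abs (f n)] with x h₁ h₂ h₃
    rw [h₂, h₃]
    exact le_ciSup h₁ n
  · have h : ∀ᵐ x ∂μ, ∀ n, |f n| x ≤ u x := ae_all_iff.2 fun n => le_def.1 (hu ⟨n, rfl⟩)
    have h' : ∀ᵐ x ∂μ, ∀ n, |f n| x = |f n x| := ae_all_iff.2 fun n => coeFn_abs _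
    filter_upwards [h, h', coeFn_supNorm f] with x h₁ h₂ h₃
    rw [h₃]
    exact ciSup_le fun n => (h₂ n).symm.le.trans (h₁ n)

theorem mem_boundedSequences_of_le {f : ℕ → L0 μ} {u : L0 μ} (h : ∀ n, |f n| ≤ u) :
    f ∈ boundedSequences μ := by
  have h : ∀ᵐ x ∂μ, ∀ n, |f n| x ≤ u x := ae_all_iff.2 fun n => le_def.1 (h n)
  have h' : ∀ᵐ x ∂μ, ∀ n, |f n| x = |f n x| := ae_all_iff.2 fun n => coeFn_abs _
  filter_upwards [h, h'] with x h₁ h₂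
  exact ⟨u x, Set.forall_mem_range.2 fun n => (h₂ n).symm.le.trans (h₁ n)⟩

theorem abs_le_supNorm {f : ℕ → L0 μ} (hf : f ∈ boundedSequences μ) (n : ℕ) :
    |f n| ≤ supNorm f := (isLUB_supNorm hf).1 ⟨n, rfl⟩

theorem supNorm_le {f : ℕ → L0 μ} (hf : f ∈ boundedSequences μ) {u : L0 μ} (h : ∀ n, |f n| ≤ u) :
    supNorm f ≤ u := (isLUB_supNorm hf).2 (Set.forall_mem_range.2 h)

theorem supNorm_nonneg (f : ℕ → L0 μ) : 0 ≤ supNorm f := by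
  refine le_def.2 ?_
  filter_upwards [coeFn_supNorm f, coeFn_zero (μ := μ)] with x h₁ h₂
  rw [h₁, h₂]
  exact Real.iSup_nonneg fun n => abs_nonneg _

/-- Boundedness is not needed: the supremum of an unbounded set of reals is `0` by convention, and
nonnegative factors still pass through it. -/
theorem supNorm_mul (c : L0 μ) (f : ℕ → L0 μ) : (supNorm fun n => c * f n) = |c| * supNorm f := by
  refine eq_iff_ae.2 ?_
  have h : ∀ᵐ x ∂μ, ∀ n, (c * f n) x = c x * f n x := ae_all_iff.2 fun n => coeFn_mul _ _
  filter_upwards [coeFn_supNorm fun n => c * f n, coeFn_mul |c| (supNorm f), coeFn_abs c,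
    coeFn_supNorm f, h] with x h₁ h₂ h₃ h₄ h₅
  rw [h₁, h₂, Pi.mul_apply, h₃, h₄, Real.mul_iSup_of_nonneg (abs_nonneg _)]
  simp only [h₅, abs_mul]

theorem supNorm_smul (c : ℝ) (f : ℕ → L0 μ) : (supNorm fun n => c • f n) = |c| • supNorm f := by
  refine eq_iff_ae.2 ?_
  have h : ∀ᵐ x ∂μ, ∀ n, (c • f n) x = c * f n x := ae_all_iff.2 fun n => coeFn_smul _ _
  filter_upwards [coeFn_supNorm fun n => c • f n, coeFn_smul |c| (supNorm f),
    coeFn_supNorm f, h] with x h₁ h₂ h₄ h₅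
  rw [h₁, h₂, Pi.smul_apply, h₄, smul_eq_mul, Real.mul_iSup_of_nonneg (abs_nonneg _)]
  simp only [h₅, abs_mul]

theorem eq_zero_of_abs_le_zero {f : L0 μ} (h : |f| ≤ 0) : f = 0 :=
  ((le_abs_self f).trans h).antisymm (neg_nonpos.1 ((neg_le_abs f).trans h))

/-- At almost every point the increments are summable uniformly in the index `n`. The pointwise
limits thus exist, and the tails of the series bound the distance to them for all `n` at once. -/
theorem boundedSequences_complete_of_summable [SigmaFinite μ] (a : ℕ → boundedSequences μ)
    (hs : Summable fun j => dist (supNorm (a (j + 1) - a j : boundedSequences μ).1) 0) :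
    ∃ v : boundedSequences μ,
      Tendsto (fun j => dist (supNorm (a j - v : boundedSequences μ).1) 0) atTop (𝓝 0) := by
  let d : ℕ → L0 μ := fun j => supNorm (a (j + 1) - a j : boundedSequences μ).1
  have hsum : ∀ᵐ x ∂μ, Summable fun j => d j x := by
    have h : ∀ᵐ x ∂μ, ∀ j, (0 : L0 μ) x ≤ d j x :=
      ae_all_iff.2 fun j => le_def.1 (supNorm_nonneg _)
    filter_upwards [ae_summable hs, h, coeFn_zero (μ := μ)] with x hx h h0
    refine hx.congr fun j => abs_of_nonneg ?_
    exact h0.symm.le.trans (h j)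
  have hstep : ∀ᵐ x ∂μ, ∀ n j,
      Dist.dist ((a j : ℕ → L0 μ) n x) ((a (j + 1) : ℕ → L0 μ) n x) ≤ d j x :=
    ae_all_iff.2 fun n => ae_all_iff.2 fun j => by
      filter_upwards [le_def.1 (abs_le_supNorm (a (j + 1) - a j).2 n),
        coeFn_abs ((a (j + 1) : ℕ → L0 μ) n - (a j : ℕ → L0 μ) n),
        coeFn_sub ((a (j + 1) : ℕ → L0 μ) n) ((a j : ℕ → L0 μ) n)] with x h₁ h₂ h₃
      change |(a (j + 1) : ℕ → L0 μ) n - (a j : ℕ → L0 μ) n| x ≤ d j x at h₁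
      rw [h₂, h₃] at h₁
      rwa [_root_.dist_comm, Real.dist_eq]
  have hlim : ∀ n, ∃ F : X → ℝ, Measurable F ∧
      ∀ᵐ x ∂μ, Tendsto (fun j => (a j : ℕ → L0 μ) n x) atTop (𝓝 (F x)) := fun n => by
    refine measurable_limit_of_tendsto_metrizable_ae
      (fun j => ((a j : ℕ → L0 μ) n).measurable_coe.aemeasurable) ?_
    filter_upwards [hsum, hstep] with x h₁ h₂
    exact cauchySeq_tendsto_of_complete (cauchySeq_of_dist_le_of_summable _ (h₂ n) h₁)
  choose F hF hFlim using hlim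
  have hdist : ∀ᵐ x ∂μ, ∀ j n, |(a j : ℕ → L0 μ) n x - of μ (F n) (hF n) x| ≤
      ∑' m, d (j + m) x := by
    have hlim : ∀ᵐ x ∂μ, ∀ n, Tendsto (fun j => (a j : ℕ → L0 μ) n x) atTop (𝓝 (F n x)) :=
      ae_all_iff.2 hFlim
    have hof : ∀ᵐ x ∂μ, ∀ n, of μ (F n) (hF n) x = F n x := ae_all_iff.2 fun n => coeFn_of _ _
    filter_upwards [hsum, hstep, hlim, hof] with x h₁ h₂ h₃ h₄ j n
    rw [h₄, ← Real.dist_eq]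
    exact dist_le_tsum_of_dist_le_of_tendsto _ (h₂ n) h₁ (h₃ n) j
  let v : boundedSequences μ := ⟨fun n => of μ (F n) (hF n), by
    filter_upwards [hdist, mem_boundedSequences.1 (a 0).2] with x h ⟨b, hb⟩
    refine ⟨b + ∑' m, d (0 + m) x, Set.forall_mem_range.2 fun n => ?_⟩
    have h₁ := h 0 n
    have h₂ : |(a 0 : ℕ → L0 μ) n x| ≤ b := hb ⟨n, rfl⟩
    rw [abs_sub_comm] at h₁
    linarith [abs_sub_abs_le_abs_sub (of μ (F n) (hF n) x) ((a 0 : ℕ → L0 μ) n x)]⟩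
  refine ⟨v, tendsto_dist_zero ?_⟩
  have hcoe : ∀ᵐ x ∂μ, ∀ j, supNorm (a j - v : boundedSequences μ).1 x =
      ⨆ n, |(a j : ℕ → L0 μ) n x - of μ (F n) (hF n) x| := ae_all_iff.2 fun j => by
    have h : ∀ᵐ x ∂μ, ∀ n, ((a j : ℕ → L0 μ) n - of μ (F n) (hF n)) x =
        (a j : ℕ → L0 μ) n x - of μ (F n) (hF n) x := ae_all_iff.2 fun n => coeFn_sub _ _
    filter_upwards [h, coeFn_supNorm ((a j - v : boundedSequences μ) : ℕ → L0 μ)] with x h₁ h₂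
    rw [h₂]
    exact iSup_congr fun n => congrArg abs (h₁ n)
  filter_upwards [hcoe, hdist] with x h₁ h₂
  refine squeeze_zero (fun j => ?_) (fun j => ?_) (tendsto_sum_nat_add fun j => d j x)
  · rw [h₁]
    exact Real.iSup_nonneg fun n => abs_nonneg _
  · rw [h₁]
    simp only [add_comm _ j]
    exact ciSup_le (h₂ j)

/-- The `L⁰(μ)`-Banach module of a.e. bounded sequences, with the pointwise supremum norm. -/
noncomputable def boundedSequencesModule (μ : Measure X) [SigmaFinite μ] :
    L0BanachModule.{u, u} μ where
  carrier := boundedSequences μ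
  pnorm f := supNorm f.1
  pnorm_nonneg f := supNorm_nonneg f.1
  pnorm_eq_zero f := by
    constructor
    · intro h
      ext1
      funext n
      exact eq_zero_of_abs_le_zero ((abs_le_supNorm f.2 n).trans h.le)
    · rintro rfl
      refine (supNorm_le (0 : boundedSequences μ).2 fun n => ?_).antisymm (supNorm_nonneg _)
      exact (abs_zero (α := L0 μ)).le
  pnorm_add_le f g := supNorm_le (f + g).2 fun n => (abs_add_le _ _).trans
    (add_le_add (abs_le_supNorm f.2 n) (abs_le_supNorm g.2 n))
  pnorm_real_smul c f := supNorm_smul c f.1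
  pnorm_smul c f := supNorm_mul c f.1
  smul_assoc c f v := _root_.smul_assoc c f v
  complete a ha := by
    choose N hN using fun k : ℕ => ha ((1 / 2) ^ k) (by positivity)
    -- `s k` is the maximum of `N 0, …, N k`. Both `s k` and `s (k + 1)` are then at least `N k`, so
    -- consecutive terms are closer than `(1 / 2) ^ k`.
    let s : ℕ → ℕ := fun k => Nat.rec (N 0) (fun k r => max (N (k + 1)) r) k
    have hs : ∀ k, N k ≤ s k := fun k => by
      cases k with
      | zero => exact le_rfl
      | succ k => exact le_max_left _ _
    have hss : ∀ k, s k ≤ s (k + 1) := fun k => le_max_right _ _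
    obtain ⟨v, hv⟩ := boundedSequences_complete_of_summable (fun k => a (s k))
      (Summable.of_nonneg_of_le (fun k => dist_zero_nonneg _)
        (fun k => (hN k _ ((hs k).trans (hss k)) _ (hs k)).le) summable_geometric_two)
    refine ⟨v, Metric.tendsto_atTop.2 fun ε hε => ?_⟩
    obtain ⟨K, hK⟩ := ha (ε / 2) (half_pos hε)
    obtain ⟨k, hk, hkK⟩ := ((hv.eventually (gt_mem_nhds (half_pos hε))).and
      (((tendsto_pow_atTop_nhds_zero_of_lt_one (by norm_num : (0 : ℝ) ≤ 1 / 2)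
        (by norm_num)).eventually (gt_mem_nhds (half_pos hε))))).exists
    refine ⟨max K (N k), fun n hn => ?_⟩
    rw [Real.dist_eq, sub_zero, abs_of_nonneg (dist_zero_nonneg _)]
    have htri : supNorm (a n - v : boundedSequences μ).1 ≤
        supNorm (a n - a (s k) : boundedSequences μ).1 + supNorm (a (s k) - v : boundedSequences μ).1 :=
      supNorm_le (a n - v : boundedSequences μ).2 fun i => by
        have h : (a n - v : boundedSequences μ).1 i =
            (a n - a (s k) : boundedSequences μ).1 i + (a (s k) - v : boundedSequences μ).1 i :=
          (sub_add_sub_cancel _ _ _).symm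
        rw [h]
        exact (abs_add_le _ _).trans (add_le_add
          (abs_le_supNorm (a n - a (s k) : boundedSequences μ).2 i)
          (abs_le_supNorm (a (s k) - v : boundedSequences μ).2 i))
    have h₁ := (dist_zero_mono (supNorm_nonneg _) htri).trans (dist_zero_add_le _ _)
    have h₂ := hN k n (le_of_max_le_right hn) _ (hs k)
    refine h₁.trans_lt ?_
    calc _ < ε / 2 + ε / 2 := add_lt_add (h₂.trans hkK) hk
      _ = ε := add_halves ε

end

end L0

/-! ## Uniqueness of completions -/

/-- Exhibits a single element as a glued sum, so that a set is contained in what it glues to. -/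
theorem isMeasurablePartition_trivial {X : Type u} [MeasurableSpace X] :
    IsMeasurablePartition fun n : ℕ => if n = 0 then (Set.univ : Set X) else ∅ where
  measurableSet n := by by_cases h : n = 0 <;> simp [h]
  disjoint i j hij := by
    by_cases hi : i = 0
    · have hj : j ≠ 0 := fun h => hij (hi.trans h.symm)
      simp [hj]
    · simp [hi]
  iUnion_eq := Set.eq_univ_of_forall fun x => Set.mem_iUnion.2 ⟨0, by simp⟩

namespace L0

theorem ind_mul_self {X : Type u} [MeasurableSpace X] {μ : Measure X} (E : Set X)
    (hE : MeasurableSet E) : ind μ E hE * ind μ E hE = ind μ E hE := by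
  have h := congrArg (ind μ E hE * ·) (ind_add_ind_compl (μ := μ) E hE)
  simpa [mul_add, ind_mul_ind_of_disjoint hE hE.compl disjoint_compl_right] using h

end L0

namespace L0BanachModule

section
variable {X : Type u} [MeasurableSpace X] {μ : Measure X} [SigmaFinite μ]

/-- A real-linear map that preserves the pointwise norm and has generating image is an isomorphism
of `L⁰(μ)`-Banach modules. -/
theorem isomorphic_of_generates {M : L0BanachModule.{u, w} μ} {N : L0BanachModule.{u, w'} μ}
    (ι : M.carrier →ₗ[ℝ] N.carrier) (hι : ∀ v, N.pnorm (ι v) = M.pnorm v)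
    (hgen : N.Generates (LinearMap.range ι)) : M.Isomorphic N := by
  have hsmul : ∀ (f : L0 μ) v, ι (f • v) = f • ι v :=
    M.map_smul_of_pnorm_le N.pnorm N.pnorm_nonneg (fun y => (N.pnorm_eq_zero y).1) N.pnorm_add_le
      N.pnorm_smul ι fun v => (hι v).le
  have hdist : ∀ v w, N.dist (ι v) (ι w) = M.dist v w := fun v w => by
    rw [dist, dist, ← map_sub, hι]
  have hdense : ∀ w, ∀ ε : ℝ, 0 < ε → ∃ u, N.dist w (ι u) < ε := fun w ε hε => by
    obtain ⟨g, ⟨E, hE, a, ha, hg⟩, hwg⟩ := hgen w (ε / 2) (half_pos hε)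
    choose b hb using ha
    let i : ℕ → L0 μ := fun n => L0.ind μ (E n) (hE.measurableSet n)
    -- `r k` is the indicator of what the first `k` pieces leave uncovered. It is eventually zero at
    -- almost every point, so the finite partial sums, which do lie in the range of `ι`, converge to
    -- `g`.
    let r : ℕ → L0 μ := fun k => 1 - ∑ n ∈ Finset.range k, i n
    have hr : ∀ n k, n < k → i n * r k = 0 := fun n k hnk => by
      rw [mul_sub, mul_one, Finset.mul_sum, Finset.sum_eq_single n, L0.ind_mul_self, sub_self]
      · exact fun j _ hj => L0.ind_mul_ind_of_disjoint _ _ (hE.disjoint hj.symm)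
      · exact fun h => absurd (Finset.mem_range.2 hnk) h
    have hsub : ∀ k, g - ι (∑ n ∈ Finset.range k, i n • b n) = r k • g := fun k => by
      rw [map_sum, sub_smul, one_smul, Finset.sum_smul]
      congr 1
      exact Finset.sum_congr rfl fun n _ => by rw [hsmul, hb, ← hg]
    have hlim : Tendsto (fun k => N.dist g (ι (∑ n ∈ Finset.range k, i n • b n))) atTop (𝓝 0) := by
      refine L0.tendsto_dist_zero ?_
      have h₁ : ∀ᵐ x ∂μ, ∀ n k, n < k → (i n * r k) x = 0 := ae_all_iff.2 fun n => ae_all_iff.2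
        fun k => eventually_imp_distrib_left.2 fun h => by
          rw [hr n k h]
          exact L0.coeFn_zero
      have h₂ : ∀ᵐ x ∂μ, ∀ n k, (i n * r k) x = i n x * r k x :=
        ae_all_iff.2 fun n => ae_all_iff.2 fun k => L0.coeFn_mul _ _
      have h₃ : ∀ᵐ x ∂μ, ∀ n, i n x = (E n).indicator (fun _ => 1) x :=
        ae_all_iff.2 fun n => L0.coeFn_ind _ _
      have h₄ : ∀ᵐ x ∂μ, ∀ k, (|r k| * N.pnorm g) x = |r k| x * N.pnorm g x :=
        ae_all_iff.2 fun k => L0.coeFn_mul _ _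
      have h₅ : ∀ᵐ x ∂μ, ∀ k, |r k| x = |r k x| := ae_all_iff.2 fun k => L0.coeFn_abs _
      filter_upwards [h₁, h₂, h₃, h₄, h₅] with x h₁ h₂ h₃ h₄ h₅
      obtain ⟨n, hn⟩ := Set.mem_iUnion.1 (hE.iUnion_eq.symm ▸ Set.mem_univ x)
      refine tendsto_const_nhds.congr' ?_
      filter_upwards [eventually_gt_atTop n] with k hk
      have h := h₁ n k hk
      rw [h₂, h₃, Set.indicator_of_mem hn, one_mul] at h
      rw [hsub, N.pnorm_smul, h₄, h₅, h, abs_zero, zero_mul]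
    obtain ⟨k, hk⟩ := (hlim.eventually (gt_mem_nhds (half_pos hε))).exists
    exact ⟨_, (N.dist_triangle _ g _).trans_lt (by linarith)⟩
  have hsurj : Function.Surjective ι := fun w => by
    -- Approximate preimages of `w` form a Cauchy sequence because `ι` preserves distances.
    -- Completeness of `M` supplies the preimage.
    choose u hu using fun k : ℕ => hdense w (1 / ((k : ℝ) + 1)) Nat.one_div_pos_of_nat
    obtain ⟨v, hv⟩ := M.complete u fun ε hε => by
      obtain ⟨K, hK⟩ := exists_nat_one_div_lt (half_pos hε)
      refine ⟨K, fun i hi j hj => ?_⟩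
      change M.dist (u i) (u j) < ε
      rw [← hdist]
      have hi' := (hu i).trans_le (Nat.one_div_le_one_div hi)
      have hj' := (hu j).trans_le (Nat.one_div_le_one_div hj)
      refine (N.dist_triangle _ w _).trans_lt ?_
      rw [N.dist_comm (ι (u i))]
      linarith
    refine ⟨v, (N.eq_of_dist_eq_zero ((L0.dist_zero_nonneg _).antisymm' ?_)).symm⟩
    have hlim := (tendsto_one_div_add_atTop_nhds_zero_nat (𝕜 := ℝ)).add hv
    rw [add_zero] at hlim
    refine ge_of_tendsto' hlim fun k => (N.dist_triangle w (ι (u k)) (ι v)).trans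
      (add_le_add (hu k).le ?_)
    rw [hdist]
    exact le_rfl
  have hinj : Function.Injective ι := fun v w h => M.eq_of_dist_eq_zero (by
    rw [← hdist, h, dist, sub_self, N.pnorm_zero, L0.dist_self])
  exact ⟨LinearEquiv.ofBijective { ι with map_smul' := hsmul } ⟨hinj, hsurj⟩, hι⟩

end

end L0BanachModule

/-! ## The bundle of bounded sequences -/

section

set_option linter.unusedSectionVars false

variable {X : Type u} [MeasurableSpace X] {Q : Type v} [MeasurableSpace Q]
  {𝔮 : Measure Q} {m : Q → Measure X}

/-- The class modulo `μ_q` of the chosen representative of an element of `L⁰(μ)`. -/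
noncomputable def L0.restrict {μ : Measure X} (ν : Measure X) (F : L0 μ) : L0 ν :=
  L0.of ν F F.measurable_coe

/-! ### Restriction to the fibres and the algebra of sections -/

section
variable [IsDisjointMeasureValuedMap 𝔮 m]

/-- The representative chosen for `F + G` is the sum of those for `F` and `G` only off a `μ`-null
set, and that set is `μ_q`-null for almost every `q`. -/
theorem ae_restrict_add (F G : L0 (integralMeasure 𝔮 m)) :
    ∀ᵐ q ∂𝔮, (F + G).restrict (m q) = F.restrict (m q) + G.restrict (m q) := by
  filter_upwards [ae_ae_of_ae_integralMeasure (L0.coeFn_add F G)] with q hq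
  exact L0.of_eq_of_ae _ (F.measurable_coe.add G.measurable_coe) hq

theorem ae_restrict_mul (F G : L0 (integralMeasure 𝔮 m)) :
    ∀ᵐ q ∂𝔮, (F * G).restrict (m q) = F.restrict (m q) * G.restrict (m q) := by
  filter_upwards [ae_ae_of_ae_integralMeasure (L0.coeFn_mul F G)] with q hq
  exact L0.of_eq_of_ae _ (F.measurable_coe.mul G.measurable_coe) hq

theorem ae_restrict_smul (c : ℝ) (F : L0 (integralMeasure 𝔮 m)) :
    ∀ᵐ q ∂𝔮, (c • F).restrict (m q) = c • F.restrict (m q) := by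
  filter_upwards [ae_ae_of_ae_integralMeasure (L0.coeFn_smul c F)] with q hq
  exact L0.of_eq_of_ae _ (F.measurable_coe.const_smul c) hq

theorem ae_restrict_zero :
    ∀ᵐ q ∂𝔮, (0 : L0 (integralMeasure 𝔮 m)).restrict (m q) = 0 := by
  filter_upwards [ae_ae_of_ae_integralMeasure
    (L0.coeFn_zero (μ := integralMeasure 𝔮 m))] with q hq
  exact L0.of_eq_of_ae _ measurable_const hq

theorem iMap_add (F G : L0 (integralMeasure 𝔮 m)) :
    iMap 𝔮 m (F + G) = iMap 𝔮 m F + iMap 𝔮 m G :=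
  RingSections.mk_eq_mk.2 (ae_restrict_add F G)

theorem iMap_mul (F G : L0 (integralMeasure 𝔮 m)) :
    iMap 𝔮 m (F * G) = iMap 𝔮 m F * iMap 𝔮 m G :=
  RingSections.mk_eq_mk.2 (ae_restrict_mul F G)

theorem iMap_smul (c : ℝ) (F : L0 (integralMeasure 𝔮 m)) :
    iMap 𝔮 m (c • F) = c • iMap 𝔮 m F :=
  RingSections.mk_eq_mk.2 (ae_restrict_smul c F)

theorem iMap_zero : iMap 𝔮 m 0 = 0 := RingSections.mk_eq_mk.2 ae_restrict_zero

theorem iMap_mem (F : L0 (integralMeasure 𝔮 m)) : iMap 𝔮 m F ∈ L0Sections 𝔮 m :=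
  iMap_bijOn.mapsTo trivial

theorem exists_iMap_eq {f : RingSections 𝔮 m} (hf : f ∈ L0Sections 𝔮 m) :
    ∃ F, iMap 𝔮 m F = f := ⟨_, iMap_jMap hf⟩

/-- `L⁰(𝔮; L⁰(μ_⋆))` as a subalgebra of `𝒮_𝔮(L⁰(μ_⋆))`. -/
noncomputable def l0SectionsSubalgebra (𝔮 : Measure Q) (m : Q → Measure X)
    [IsDisjointMeasureValuedMap 𝔮 m] : NonUnitalSubalgebra ℝ (RingSections 𝔮 m) where
  carrier := L0Sections 𝔮 m
  zero_mem' := iMap_zero (𝔮 := 𝔮) (m := m) ▸ iMap_mem 0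
  add_mem' := fun {a b} ha hb => by
    obtain ⟨F, rfl⟩ := exists_iMap_eq ha
    obtain ⟨G, rfl⟩ := exists_iMap_eq hb
    exact iMap_add F G ▸ iMap_mem _
  mul_mem' := fun {a b} ha hb => by
    obtain ⟨F, rfl⟩ := exists_iMap_eq ha
    obtain ⟨G, rfl⟩ := exists_iMap_eq hb
    exact iMap_mul F G ▸ iMap_mem _
  smul_mem' := fun c a ha => by
    obtain ⟨F, rfl⟩ := exists_iMap_eq ha
    exact iMap_smul c F ▸ iMap_mem _

/-- With the largest possible algebra every element of `L⁰(μ)` is glued from itself, so no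
approximation is needed. -/
theorem isDense_glueSections_l0Sections :
    L0.IsDense (glueSections 𝔮 m (l0SectionsSubalgebra 𝔮 m)) := fun g ε hε => by
  exact ⟨g, ⟨_, fun _ => iMap 𝔮 m g, isMeasurablePartition_trivial, fun _ => iMap_mem g,
    fun _ => rfl⟩, (L0.dist_self g).trans_lt hε⟩

end

/-! ### Sections of bounded sequences and the bundle -/

variable [∀ q, SigmaFinite (m q)]

/-- The constant family of modules of bounded sequences. -/
noncomputable abbrev sequenceBundle (m : Q → Measure X) [∀ q, SigmaFinite (m q)] :
    ∀ q, L0BanachModule.{u, u} (m q) := fun q => L0.boundedSequencesModule (m q)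

/-- A bounded sequence as a function, and every unbounded sequence replaced by `0`. -/
noncomputable def toBoundedSequence {μ : Measure X} (f : ℕ → L0 μ) : L0.boundedSequences μ :=
  open Classical in if h : f ∈ L0.boundedSequences μ then ⟨f, h⟩ else 0

theorem coe_toBoundedSequence {μ : Measure X} {f : ℕ → L0 μ} (h : f ∈ L0.boundedSequences μ) :
    (toBoundedSequence f : ℕ → L0 μ) = f := by
  rw [toBoundedSequence, dif_pos h]

variable [IsDisjointMeasureValuedMap 𝔮 m] {M : L0BanachModule.{u, w} (integralMeasure 𝔮 m)}
  {φ : ℕ → M.carrier →ₗ[L0 (integralMeasure 𝔮 m)] L0 (integralMeasure 𝔮 m)}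

/-- The section `q ↦ ([φₙ(v)]_{μ_q})ₙ`. -/
noncomputable def rawSection (φ : ℕ → M.carrier →ₗ[L0 (integralMeasure 𝔮 m)]
    L0 (integralMeasure 𝔮 m)) (v : M.carrier) (q : Q) : L0.boundedSequences (m q) :=
  toBoundedSequence fun n => (φ n v).restrict (m q)

/-- All `|φ n v|` lie below `|v|`, so the sequence is bounded off a `μ`-null set. The default value
`0` therefore affects only a negligible set of `q`. -/
theorem ae_rawSection (hφ : ∀ v, IsLUB (Set.range fun n => |φ n v|) (M.pnorm v)) (v : M.carrier) :
    ∀ᵐ q ∂𝔮, (rawSection φ v q : ℕ → L0 (m q)) = fun n => (φ n v).restrict (m q) := by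
  have h : (fun n => φ n v) ∈ L0.boundedSequences (integralMeasure 𝔮 m) :=
    L0.mem_boundedSequences_of_le fun n => (hφ v).1 ⟨n, rfl⟩
  filter_upwards [ae_ae_of_ae_integralMeasure (L0.mem_boundedSequences.1 h)] with q hq
  refine coe_toBoundedSequence (L0.mem_boundedSequences.2 ?_)
  have h' : ∀ᵐ x ∂(m q), ∀ n, (φ n v).restrict (m q) x = φ n v x :=
    ae_all_iff.2 fun n => L0.coeFn_of _ _
  filter_upwards [hq, h'] with x h₁ h₂
  simpa only [h₂] using h₁

/-- The least upper bound `|v|` of countably many functions is their pointwise supremum almost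
everywhere, and pointwise suprema commute with restriction to a fibre. -/
theorem ae_supNorm_rawSection (hφ : ∀ v, IsLUB (Set.range fun n => |φ n v|) (M.pnorm v))
    (v : M.carrier) :
    ∀ᵐ q ∂𝔮, L0.supNorm (rawSection φ v q).1 = (M.pnorm v).restrict (m q) := by
  have h : (fun n => φ n v) ∈ L0.boundedSequences (integralMeasure 𝔮 m) :=
    L0.mem_boundedSequences_of_le fun n => (hφ v).1 ⟨n, rfl⟩
  have heq : M.pnorm v = L0.supNorm fun n => φ n v := (hφ v).unique (L0.isLUB_supNorm h)
  filter_upwards [ae_rawSection hφ v,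
    ae_ae_of_ae_integralMeasure (L0.coeFn_supNorm fun n => φ n v)] with q h₁ h₂
  rw [h₁, heq]
  refine L0.eq_iff_ae.2 ?_
  have h' : ∀ᵐ x ∂(m q), ∀ n, (φ n v).restrict (m q) x = φ n v x :=
    ae_all_iff.2 fun n => L0.coeFn_of _ _
  filter_upwards [h', h₂, L0.coeFn_supNorm fun n => (φ n v).restrict (m q),
    L0.coeFn_of (μ := m q) _ (L0.supNorm fun n => φ n v).measurable_coe] with x h₃ h₄ h₅ h₆
  rw [h₅, L0.restrict, h₆, h₄]
  simp only [h₃]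

theorem moduleSections_mk_eq {s t : ∀ q, L0.boundedSequences (m q)}
    (h : ∀ᵐ q ∂𝔮, (s q : ℕ → L0 (m q)) = t q) :
    (Submodule.Quotient.mk s : ModuleSections 𝔮 (sequenceBundle m)) = Submodule.Quotient.mk t := by
  refine (Submodule.Quotient.eq (nullSections 𝔮 (sequenceBundle m))).2 ?_
  filter_upwards [h] with q hq
  exact sub_eq_zero.2 (Subtype.ext hq)

/-- The real-linear map `v ↦ [q ↦ ([φₙ(v)]_{μ_q})ₙ]`. -/
noncomputable def toSections (hφ : ∀ v, IsLUB (Set.range fun n => |φ n v|) (M.pnorm v)) :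
    M.carrier →ₗ[ℝ] ModuleSections 𝔮 (sequenceBundle m) where
  toFun v := Submodule.Quotient.mk (rawSection φ v)
  map_add' v w := by
    refine moduleSections_mk_eq (t := fun q => rawSection φ v q + rawSection φ w q) ?_
    -- Countability of the functionals is what allows one exceptional set of `q` for all `n`.
    have h : ∀ᵐ q ∂𝔮, ∀ n, (φ n v + φ n w).restrict (m q) =
        (φ n v).restrict (m q) + (φ n w).restrict (m q) :=
      ae_all_iff.2 fun n => ae_restrict_add _ _
    filter_upwards [ae_rawSection hφ v, ae_rawSection hφ w, ae_rawSection hφ (v + w), h]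
      with q h₁ h₂ h₃ h₄
    rw [h₃, Submodule.coe_add, h₁, h₂]
    funext n
    rw [map_add, h₄, Pi.add_apply]
  map_smul' c v := by
    refine moduleSections_mk_eq (t := fun q => c • rawSection φ v q) ?_
    have h : ∀ᵐ q ∂𝔮, ∀ n, (c • φ n v).restrict (m q) = c • (φ n v).restrict (m q) :=
      ae_all_iff.2 fun n => ae_restrict_smul _ _
    filter_upwards [ae_rawSection hφ v, ae_rawSection hφ (c • v), h] with q h₁ h₂ h₃
    rw [h₂]
    funext n
    rw [LinearMap.map_smul_of_tower, h₃]
    exact congrArg (c • ·) (congrFun h₁ n).symm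

theorem sectionNorm_toSections (hφ : ∀ v, IsLUB (Set.range fun n => |φ n v|) (M.pnorm v))
    (v : M.carrier) :
    sectionNorm (sequenceBundle m) (toSections hφ v) = iMap 𝔮 m (M.pnorm v) :=
  RingSections.mk_eq_mk.2 (ae_supNorm_rawSection hφ v)

theorem iMap_smul_toSections (hφ : ∀ v, IsLUB (Set.range fun n => |φ n v|) (M.pnorm v))
    (F : L0 (integralMeasure 𝔮 m)) (v : M.carrier) :
    iMap 𝔮 m F • toSections hφ v = toSections hφ (F • v) := by
  refine moduleSections_mk_eq (s := fun q => F.restrict (m q) • rawSection φ v q) ?_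
  have h : ∀ᵐ q ∂𝔮, ∀ n, (F * φ n v).restrict (m q) = F.restrict (m q) * (φ n v).restrict (m q) :=
    ae_all_iff.2 fun n => ae_restrict_mul _ _
  filter_upwards [ae_rawSection hφ v, ae_rawSection hφ (F • v), h] with q h₁ h₂ h₃
  rw [h₂, Submodule.coe_smul, h₁]
  funext n
  rw [map_smul, smul_eq_mul, h₃, Pi.smul_apply, smul_eq_mul]

/-- A section that vanishes almost everywhere has zero norm, and `iMap` is injective on `L⁰(μ)`, so
`|v| = 0`. -/
theorem toSections_injective (hφ : ∀ v, IsLUB (Set.range fun n => |φ n v|) (M.pnorm v)) :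
    Function.Injective (toSections hφ) := by
  refine (injective_iff_map_eq_zero _).2 fun v hv => ?_
  have h := sectionNorm_toSections hφ v
  rw [hv, ← map_zero (toSections hφ), sectionNorm_toSections hφ, M.pnorm_zero] at h
  exact (M.pnorm_eq_zero v).1 (iMap_bijOn.injOn trivial trivial h).symm

/-- The Banach module bundle of a module with a norming sequence of functionals. -/
noncomputable def bundleOfNorming (hφ : ∀ v, IsLUB (Set.range fun n => |φ n v|) (M.pnorm v)) :
    BanachModuleBundle.{u, v, u} 𝔮 m where
  M := sequenceBundle m
  Φ := l0SectionsSubalgebra 𝔮 m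
  Φ_subset := subset_rfl
  Φ_dense := isDense_glueSections_l0Sections
  Θ := LinearMap.range (toSections hφ)
  smul_mem f hf s hs := by
    obtain ⟨F, rfl⟩ := exists_iMap_eq hf
    obtain ⟨v, rfl⟩ := hs
    exact ⟨F • v, (iMap_smul_toSections hφ F v).symm⟩
  norm_mem s hs := by
    obtain ⟨v, rfl⟩ := hs
    exact sectionNorm_toSections hφ v ▸ iMap_mem _

/-- The space of sections of the bundle is a copy of the module. -/
noncomputable def equivSections (hφ : ∀ v, IsLUB (Set.range fun n => |φ n v|) (M.pnorm v)) :
    M.carrier ≃ₗ[ℝ] (bundleOfNorming hφ).Θ :=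
  LinearEquiv.ofInjective (toSections hφ) (toSections_injective hφ)

theorem norm_equivSections (hφ : ∀ v, IsLUB (Set.range fun n => |φ n v|) (M.pnorm v))
    (v : M.carrier) : (bundleOfNorming hφ).norm (equivSections hφ v) = M.pnorm v :=
  (congrArg (jMap 𝔮 m) (sectionNorm_toSections hφ v)).trans (jMap_iMap _)

end

/-! ### The integral of the bundle -/

theorem L0BanachModule.generates_of_eq_top {X : Type u} [MeasurableSpace X] {μ : Measure X}
    [SigmaFinite μ] (M : L0BanachModule.{u, w} μ) {V : Submodule ℝ M.carrier} (hV : V = ⊤) :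
    M.Generates V := fun v ε hε => by
  refine ⟨v, ⟨_, isMeasurablePartition_trivial, fun _ => v, fun _ => hV ▸ Submodule.mem_top,
    fun _ => rfl⟩, ?_⟩
  rwa [L0BanachModule.dist, sub_self, M.pnorm_zero, L0.dist_self]

theorem mainTheorem5 {X : Type u} [MeasurableSpace X] {Q : Type v} [MeasurableSpace Q]
    (𝔮 : Measure Q) [SigmaFinite 𝔮] (m : Q → Measure X) [∀ q, SigmaFinite (m q)]
    [IsDisjointMeasureValuedMap 𝔮 m]
    (M : L0BanachModule.{u, w} (integralMeasure 𝔮 m)) (hM : M.CountablyGenerated) :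
    ∃ B : BanachModuleBundle.{u, v, u} 𝔮 m,
      (∃ N : L0BanachModule.{u, w} (integralMeasure 𝔮 m), B.IsIntegral N) ∧
      ∀ N : L0BanachModule.{u, w} (integralMeasure 𝔮 m), B.IsIntegral N → M.Isomorphic N := by
  obtain ⟨φ, hφ⟩ := hM.exists_norming_sequence
  -- `M` itself is an integral: the inverse of `equivSections` maps `Θ` onto it and preserves the
  -- norm.
  refine ⟨bundleOfNorming hφ, ⟨M, (equivSections hφ).symm, fun s => ?_,
    M.generates_of_eq_top (LinearEquiv.range _)⟩, fun N ⟨ι, hι, hgen⟩ => ?_⟩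
  · rw [← norm_equivSections hφ]
    exact congrArg _ ((equivSections hφ).apply_symm_apply s)
  -- Precomposing `ι` with the bijection from `M` to `Θ` keeps its range, hence the generating
  -- property, and yields a norm-preserving map from `M` to `N`.
  · refine L0BanachModule.isomorphic_of_generates (ι ∘ₗ (equivSections hφ).toLinearMap)
      (fun v => (hι _).trans (norm_equivSections hφ v)) ?_
    rwa [LinearMap.range_comp_of_range_eq_top _ (LinearEquiv.range _)]
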